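/- **Setting.** Let $n\ge 1$ and let $\mathcal S\subset\mathbb R^n$ be compact, such that every nonempty relatively open subset of $\mathcal S$ has positive Lebesgue measure. Consider a Markov decision process with state space $\mathcal S$, action space $\mathbb R$, transition density $p(s'\mid s,a)\ge 0$ with respect to Lebesgue measure on $\mathcal S$ (jointly measurable, $\int_{\mathcal S}p(s'\mid s,a)\,ds'=1$) and measurable reward $r:\mathcal S\times\mathbb R\to\mathbb R$. Assume that $p$ and $r$ are bounded and that, for each fixed action $a$, $(s,s')\mapsto p(s'\mid s,a)$ and $s\mapsto r(s,a)$ are continuous. Let $0<\gamma<1$ and $\sigma^2>0$. Let $\mathcal H$ be a reproducing kernel Hilbert space of functions $\mathcal S\to\mathbb R$ with continuous kernel $\kappa$ that is strictly positive definite in the following integral sense: for every $x\in\mathcal S$, $c\in\mathbb R$ and $g\in L^2(\mathcal S)$, unless $c=0$ and $g=0$ almost everywhere, $$c^2\kappa(x,x)+2c\int_{\mathcal S}\kappa(x,s)g(s)\,ds+\int_{\mathcal S}\int_{\mathcal S}g(s)\kappa(s,s')g(s')\,ds'\,ds>0 .$$ For $h\in\mathcal H$ let $\pi_h(\cdot\mid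 s)$ be the normal distribution $\mathcal N(h(s),\sigma^2)$, let $(s_t,a_t)_{t\ge 0}$ be the process with $a_t\sim\pi_h(\cdot\mid s_t)$ and $s_{t+1}\sim p(\cdot\mid s_t,a_t)$, and for $s\in\mathcal S$ put $$U_{s}(h)=\mathbb E\Big[\sum_{t=0}^\infty\gamma^t r(s_t,a_t)\,\Big|\,h,\ s_0=s\Big].$$ Call $h$ a critical point of $U_s:\mathcal H\to\mathbb R$ if $U_s$ is Fréchet differentiable at $h$ with gradient $0$. For $s_0\in\mathcal S$ let $$\mathcal S_0=\{s_0\}\cup\{s\in\mathcal S:\ p(s_t=s\mid s_0)>0\ \text{for some } t\ge 1\}$$ be the set of states reachable from $s_0$ under $\pi_h$, where the densities are given by $p(s_1=s\mid s_0)=\int\pi_h(a\mid s_0)p(s\mid s_0,a)\,da$ and $p(s_{t+1}=s\mid s_0)=\int_{\mathcal S}p(s_t=x\mid s_0)\,p(s_1=s\mid s_0=x)\,dx$. **Proposition.** Let $s_0\in\mathcal S$ and $h\in\mathcal H$. If $h$ is a critical point of $U_{s_0}$, then $h$ is a critical point of $U_{s}$ for every $s\in\mathcal S_0$; that is, of $U_{s_l}$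 for every $l\ge 0$ and every state $s_l\in\mathcal S_0$. -/

import Mathlib

open MeasureTheory ProbabilityTheory

noncomputable section

namespace OnlinePG

variable {n : ℕ} {S : TopologicalSpace.Compacts (EuclideanSpace ℝ (Fin n))}

/-- The reference measure on a compact state space `S ⊆ ℝⁿ` is Lebesgue measure restricted
to `S`. -/
instance instMeasureSpace : MeasureSpace S where
  volume := Measure.comap (Subtype.val : S → EuclideanSpace ℝ (Fin n)) volume

instance instIsFiniteMeasureVolume : IsFiniteMeasure (volume : Measure S) := by
  constructor
  have h : (volume : Measure S) Set.univ = volume (S : Set (EuclideanSpace ℝ (Fin n))) := by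
    have := comap_subtype_coe_apply S.isCompact.measurableSet
      (volume : Measure (EuclideanSpace ℝ (Fin n))) Set.univ
    rw [Set.image_univ, Subtype.range_coe] at this
    exact this
  rw [h]
  exact S.isCompact.measure_lt_top

/-- A Markov decision process with compact state space `S ⊆ ℝⁿ` and action space `ℝ`:
`p s a s'` is the transition density (with respect to Lebesgue measure on `S`) of moving from `s`
to `s'` under the action `a`, and `r s a` is the reward. -/
structure MDP (S : TopologicalSpace.Compacts (EuclideanSpace ℝ (Fin n))) where
  p : S → ℝ → S → ℝ
  p_nonneg : ∀ s a s', 0 ≤ p s a s'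
  p_measurable : Measurable fun x : (S × ℝ) × S => p x.1.1 x.1.2 x.2
  p_integral : ∀ s a, ∫ s', p s a s' = 1
  r : S → ℝ → ℝ
  r_measurable : Measurable fun x : S × ℝ => r x.1 x.2

/-- The transition kernel `P(ds' | s, a) = p(s' | s, a) ds'`. -/
def MDP.transition (M : MDP S) : Kernel (S × ℝ) S :=
  Kernel.withDensity (Kernel.const (S × ℝ) (volume : Measure S))
    (fun x s' => ENNReal.ofReal (M.p x.1 x.2 s'))

instance MDP.instIsMarkovKernelTransition (M : MDP S) : IsMarkovKernel M.transition := by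
  constructor
  intro x
  constructor
  have hm : Measurable (Function.uncurry
      fun (x : S × ℝ) (s' : S) => ENNReal.ofReal (M.p x.1 x.2 s')) :=
    M.p_measurable.ennreal_ofReal
  have hi : Integrable (M.p x.1 x.2) := by
    by_contra h
    have := M.p_integral x.1 x.2
    rw [integral_undef h] at this
    exact zero_ne_one this
  rw [MDP.transition, Kernel.withDensity_apply' _ hm, Kernel.const_apply, setLIntegral_univ,
    ← ofReal_integral_eq_lintegral_ofReal hi (ae_of_all _ (M.p_nonneg x.1 x.2)),
    M.p_integral, ENNReal.ofReal_one]

theorem measurable_gaussianReal_mean (v : NNReal) : Measurable fun μ : ℝ => gaussianReal μ v := by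
  have h : (fun μ : ℝ => gaussianReal μ v) =
      fun μ : ℝ => (gaussianReal 0 v).map (fun x => x + μ) := by
    funext μ
    rw [gaussianReal_map_add_const, zero_add]
  rw [h]
  refine Measure.measurable_of_measurable_coe _ fun s hs => ?_
  have : (fun μ : ℝ => (gaussianReal 0 v).map (fun x => x + μ) s) =
      fun μ : ℝ => gaussianReal 0 v (Prod.mk μ ⁻¹' ((fun q : ℝ × ℝ => q.2 + q.1) ⁻¹' s)) := by
    funext μ
    rw [Measure.map_apply (by fun_prop) hs]
    rfl
  rw [this]
  exact measurable_measure_prodMk_left ((by fun_prop : Measurable fun q : ℝ × ℝ => q.2 + q.1) hs)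

/-- The Gaussian policy `π_m(· | s)`, the normal law with mean `m s` and variance `v`. -/
def gaussianPolicy (v : NNReal) (m : C(S, ℝ)) : Kernel S ℝ where
  toFun s := gaussianReal (m s) v
  measurable' := (measurable_gaussianReal_mean v).comp m.continuous.measurable

instance instIsMarkovKernelGaussianPolicy (v : NNReal) (m : C(S, ℝ)) :
    IsMarkovKernel (gaussianPolicy v m) :=
  ⟨fun s => inferInstanceAs (IsProbabilityMeasure (gaussianReal (m s) v))⟩

/-- One step of the state-action chain under the policy `π`:
`(s, a) ↦ (s', a')` with `s' ∼ P(· | s, a)` and `a' ∼ π(· | s')`. -/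
def MDP.step (M : MDP S) (π : Kernel S ℝ) [IsMarkovKernel π] : Kernel (S × ℝ) (S × ℝ) :=
  M.transition.compProd (Kernel.prodMkLeft (S × ℝ) π)

instance MDP.instIsMarkovKernelStep (M : MDP S) (π : Kernel S ℝ) [IsMarkovKernel π] :
    IsMarkovKernel (M.step π) :=
  inferInstanceAs (IsMarkovKernel (M.transition.compProd (Kernel.prodMkLeft (S × ℝ) π)))

/-- `M.step π`, as a kernel from histories up to time `k` to the state-action pair at time
`k + 1`. -/
def MDP.historyStep (M : MDP S) (π : Kernel S ℝ) [IsMarkovKernel π] (k : ℕ) :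
    Kernel ((_ : Finset.Iic k) → S × ℝ) (S × ℝ) :=
  (M.step π).comap (fun ω => ω ⟨k, Finset.mem_Iic.2 le_rfl⟩) (measurable_pi_apply _)

instance MDP.instIsMarkovKernelHistoryStep (M : MDP S) (π : Kernel S ℝ) [IsMarkovKernel π]
    (k : ℕ) : IsMarkovKernel (M.historyStep π k) :=
  Kernel.IsMarkovKernel.comap (M.step π) (measurable_pi_apply _)

/-- The law of the trajectory `(s_t, a_t)_{t ≥ 0}` of the process started at the state `s₀`
and controlled by the policy `π`. -/
def MDP.trajectoryLaw (M : MDP S) (π : Kernel S ℝ) [IsMarkovKernel π] (s₀ : S) :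
    Measure (ℕ → S × ℝ) :=
  Kernel.trajMeasure (X := fun _ => S × ℝ) ((π s₀).map fun a => (s₀, a)) (M.historyStep π)

/-- The value `E[∑_{t ≥ 0} γ^t r(s_t, a_t) | s_0 = s₀]` of the policy `π`. -/
def MDP.value (M : MDP S) (γ : ℝ) (π : Kernel S ℝ) [IsMarkovKernel π] (s₀ : S) : ℝ :=
  ∫ ω, ∑' t : ℕ, γ ^ t * M.r (ω t).1 (ω t).2 ∂(M.trajectoryLaw π s₀)

/-- The density at `s'` of the next state, from the state `s`, under the Gaussian policy:
`∫ π_m(a | s) p(s' | s, a) da`. -/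
def MDP.stepDensity (M : MDP S) (v : NNReal) (m : C(S, ℝ)) (s s' : S) : ℝ :=
  ∫ a : ℝ, gaussianPDFReal (m s) v a * M.p s a s'

/-- `M.stateDensity v m t s s'` is the density `p(s_{t+1} = s' | s_0 = s)` of the state at time
`t + 1` under the Gaussian policy. -/
def MDP.stateDensity (M : MDP S) (v : NNReal) (m : C(S, ℝ)) : ℕ → S → S → ℝ
  | 0 => M.stepDensity v m
  | t + 1 => fun s s' => ∫ x : S, M.stateDensity v m t s x * M.stepDensity v m x s'

/-- The set of states reachable from `s₀`: those `s` with `p(s_t = s | s_0 = s₀) > 0` for some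
`t ≥ 0`. At `t = 0` the law of the state is the point mass at `s₀`. -/
def MDP.reachable (M : MDP S) (v : NNReal) (m : C(S, ℝ)) (s₀ : S) : Set S :=
  {s | s = s₀ ∨ ∃ t : ℕ, 0 < M.stateDensity v m t s₀ s}

variable (H : Type*) [NormedAddCommGroup H] [InnerProductSpace ℝ H] [CompleteSpace H]
  [RKHS ℝ H S ℝ]

/-- The scalar reproducing kernel `κ(s, s')` of a reproducing kernel Hilbert space of real
functions on `S`. -/
def scalarKernel (s s' : S) : ℝ := RKHS.kernel H s s' 1

variable {H}

theorem continuous_of_scalarKernel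
    (hκ : Continuous fun x : S × S => scalarKernel H x.1 x.2) (h : H) :
    Continuous (h : S → ℝ) := by
  have hk : ∀ x y : S, inner ℝ (RKHS.kerFun H x (1 : ℝ)) (RKHS.kerFun H y (1 : ℝ)) =
      scalarKernel H y x := by
    intro x y
    rw [← RKHS.kernel_inner]
    simp [scalarKernel]
  have hdist : ∀ x y : S, ‖RKHS.kerFun H x (1 : ℝ) - RKHS.kerFun H y (1 : ℝ)‖ =
      √(scalarKernel H x x - 2 * scalarKernel H y x + scalarKernel H y y) := by
    intro x y
    rw [← hk x x, ← hk x y, ← hk y y, real_inner_self_eq_norm_sq, real_inner_self_eq_norm_sq,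
      ← norm_sub_sq_real, Real.sqrt_sq (norm_nonneg _)]
  have hval : ∀ x : S, h x = inner ℝ (RKHS.kerFun H x (1 : ℝ)) h := by
    intro x
    rw [RKHS.kerFun_inner, real_inner_eq_re_inner]
    simp
  have key : Continuous fun s : S => RKHS.kerFun H s (1 : ℝ) := by
    rw [continuous_iff_continuousAt]
    intro s
    have h1 : Continuous fun x : S => scalarKernel H x x :=
      hκ.comp' (f := fun x : S => (x, x)) (by fun_prop)
    have h2 : Continuous fun x : S => scalarKernel H s x :=
      hκ.comp' (f := fun x : S => (s, x)) (by fun_prop)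
    have hc : Continuous fun x : S =>
        √(scalarKernel H x x - 2 * scalarKernel H s x + scalarKernel H s s) :=
      ((h1.sub (h2.const_mul 2)).add continuous_const).sqrt
    have h3 := hc.tendsto s
    rw [show scalarKernel H s s - 2 * scalarKernel H s s + scalarKernel H s s = 0 by ring,
      Real.sqrt_zero] at h3
    rw [ContinuousAt, tendsto_iff_norm_sub_tendsto_zero]
    exact h3.congr fun x => (hdist x s).symm
  exact (key.inner continuous_const : Continuous fun x : S =>
    inner ℝ (RKHS.kerFun H x (1 : ℝ)) h).congr fun x => (hval x).symm

/-- The mean map `h ∈ H` of a policy, as a continuous function on `S`. -/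
def meanMap (hκ : Continuous fun x : S × S => scalarKernel H x.1 x.2) (h : H) : C(S, ℝ) :=
  ⟨h, continuous_of_scalarKernel hκ h⟩

/-- The value function `U_{s₀} : H → ℝ`, as a function of the mean map of the Gaussian policy. -/
def MDP.U (M : MDP S) (γ : ℝ) (v : NNReal)
    (hκ : Continuous fun x : S × S => scalarKernel H x.1 x.2) (s₀ : S) (h : H) : ℝ :=
  M.value γ (gaussianPolicy v (meanMap hκ h)) s₀

/-- `h` is a critical point of `F : H → ℝ`: `F` is Fréchet differentiable at `h`, with gradient
zero. -/
def IsCriticalPoint (F : H → ℝ) (h : H) : Prop := HasGradientAt F 0 h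

/-- Strict positive definiteness of a kernel `k` in the integral sense: the quadratic form
`∬ k dμ dμ` is positive at every nonzero `μ = c δ_x + g ds` with `g ∈ L²(S)`. -/
def IntegrallyStrictlyPosDef (k : S → S → ℝ) : Prop :=
  ∀ (x : S) (c : ℝ) (g : S → ℝ), MemLp g 2 volume → ¬ (c = 0 ∧ g =ᵐ[volume] 0) →
    0 < c ^ 2 * k x x + 2 * c * (∫ s, k x s * g s) + ∫ s, ∫ s', g s * k s s' * g s'

end OnlinePG

end

/-! Write `P` for the transition operator on `C(S, ℝ)` under the Gaussian policy, `V` for the value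
function and `D(s)` for the average of `Q(s, ·)` against the derivative of the Gaussian density in
its mean, where `Q(s, a) = r(s, a) + γ E[V(s')]`. Differentiating the fixed-point equation `V = R +
γ P V` in the mean map gives the policy gradient theorem: the derivative of `U_s` in the direction
`g` is `(∑ γᵗ Pᵗ)(D g)(s) = D(s) g(s) + ∫ ρ_s D g`, with `ρ_s` the discounted sum of the state
densities at times at least one (`hasFDerivAt_valueFn`, `resolvent_eq_discountedDensity`).

If `h` is critical for `U_{s₀}`, the signed measure `D(s₀) δ_{s₀} + ρ_{s₀} D dx` annihilates `H`.
Testing against kernel sections shows that its energy is zero, so strict positive definiteness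
forces `D(s₀) = 0` and `ρ_{s₀} D = 0` almost everywhere. The state densities and `D` are continuous
and Lebesgue measure charges every nonempty open subset of `S`, so `D` vanishes at every reachable
state (`advantage_eq_zero_of_reachable`). Whatever is reachable from a reachable state is itself
reachable from `s₀` (`reachable_of_stateDensity_pos`), so the gradient formula at such a state
involves only zeros of `D`. -/

namespace OnlinePG

open Filter Topology

/-! ### Gaussian averages as functions of the mean, uniformly over bounded integrands. -/

section Gaussian

variable {v : NNReal}

/-- Completing the square. For `v = 0` both densities are zero by convention. -/
theorem gaussianPDFReal_add_mean (μ δ : ℝ) (v : NNReal) (a : ℝ) :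
    gaussianPDFReal (μ + δ) v a =
      gaussianPDFReal μ v a * Real.exp (δ * ((a - μ) / v) - δ ^ 2 / (2 * v)) := by
  by_cases hv : v = 0
  · simp [hv]
  have hv' : (v : ℝ) ≠ 0 := by exact_mod_cast hv
  simp only [gaussianPDFReal_def]
  rw [mul_assoc _ (Real.exp _), ← Real.exp_add]
  congr 2
  field_simp
  ring

theorem abs_exp_sub_one_sub_le (x : ℝ) : |Real.exp x - 1 - x| ≤ |x| ^ 2 * Real.exp |x| := by
  have h := Complex.norm_exp_sub_sum_le_norm_mul_exp (x : ℂ) 2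
  simp only [Finset.sum_range_succ, Finset.sum_range_zero, pow_zero, Nat.factorial, pow_one,
    Nat.cast_one, div_one, zero_add, mul_one, Complex.norm_real, Real.norm_eq_abs] at h
  have e : Complex.exp x - (1 + x) = ((Real.exp x - 1 - x : ℝ) : ℂ) := by
    push_cast; ring
  rwa [e, Complex.norm_real, Real.norm_eq_abs] at h

/-- Envelope of the second-order remainder of the Gaussian density in its mean. -/
noncomputable def gaussianEnvelope (v : NNReal) (z : ℝ) : ℝ :=
  2 * Real.exp (2 * ((|z| + 1) / v)) + 1 / (2 * v)

theorem integrable_gaussianPDFReal_mul_iff (hv : v ≠ 0) {μ : ℝ} {f : ℝ → ℝ} :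
    Integrable (fun a => gaussianPDFReal μ v a * f a) ↔ Integrable f (gaussianReal μ v) := by
  rw [gaussianReal_of_var_ne_zero _ hv, gaussianPDF_def,
    integrable_withDensity_iff_integrable_smul₀' (by fun_prop) (by simp)]
  refine integrable_congr (ae_of_all _ fun a => ?_)
  simp [ENNReal.toReal_ofReal (gaussianPDFReal_nonneg μ v a)]

theorem integrable_gaussianPDFReal_mul_envelope (hv : v ≠ 0) :
    Integrable (fun z => gaussianPDFReal 0 v z * gaussianEnvelope v z) := by
  rw [integrable_gaussianPDFReal_mul_iff hv]
  have h : Integrable (fun z : ℝ => Real.exp (2 / v * |z|)) (gaussianReal 0 v) :=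
    integrable_exp_mul_abs (integrable_exp_mul_gaussianReal _) (integrable_exp_mul_gaussianReal _)
  refine ((h.const_mul (2 * Real.exp (2 / v))).add (integrable_const (1 / (2 * (v : ℝ))))).congr
    (ae_of_all _ fun z => ?_)
  simp only [Pi.add_apply, gaussianEnvelope]
  rw [mul_assoc, ← Real.exp_add]
  congr 3
  ring

/-- The score weight: derivative of the Gaussian density with respect to its mean. -/
noncomputable def scorePDF (μ : ℝ) (v : NNReal) (a : ℝ) : ℝ :=
  (a - μ) / v * gaussianPDFReal μ v a

/-- By the tilting formula the remainder is the density times `(e^u - 1 - u) - δ² / (2v)`, where `u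
= O(δ)`. The bound depends on `a` only through `a - μ`, so its integral is the same for all means.
-/
theorem abs_gaussianPDFReal_remainder_le (hv : v ≠ 0) (μ : ℝ) {δ : ℝ} (hδ : |δ| ≤ 1) (a : ℝ) :
    |gaussianPDFReal (μ + δ) v a - gaussianPDFReal μ v a - δ * scorePDF μ v a| ≤
      δ ^ 2 * (gaussianPDFReal 0 v (a - μ) * gaussianEnvelope v (a - μ)) := by
  have hv' : (0 : ℝ) < v := by exact_mod_cast pos_iff_ne_zero.2 hv
  rw [gaussianPDFReal_sub, zero_add, gaussianPDFReal_add_mean, scorePDF]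
  set z := a - μ
  have hφ := gaussianPDFReal_nonneg μ v a
  set φ := gaussianPDFReal μ v a
  set b := (|z| + 1) / (v : ℝ) with hb
  have hb0 : 0 ≤ b := by positivity
  set u := δ * (z / v) - δ ^ 2 / (2 * v) with hu
  have hδ2 : δ ^ 2 = |δ| ^ 2 := (sq_abs δ).symm
  have hub : |u| ≤ |δ| * b := by
    have e : u = δ * ((z - δ / 2) / v) := by rw [hu]; field_simp
    rw [e, abs_mul, abs_div, abs_of_pos hv', hb]
    gcongr
    calc |z - δ / 2| ≤ |z| + |δ / 2| := abs_sub _ _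
      _ ≤ |z| + 1 := by
        rw [abs_div, abs_two]; linarith
  have hub' : |u| ≤ b := hub.trans (by nlinarith)
  have h1 : |Real.exp u - 1 - u| ≤ δ ^ 2 * (2 * Real.exp (2 * b)) := by
    -- The polynomial factor is absorbed into an exponential of `|z|`, which is integrable against a
    -- Gaussian.
    have hq : b ^ 2 ≤ 2 * Real.exp b := by
      have := Real.quadratic_le_exp_of_nonneg hb0
      nlinarith
    calc |Real.exp u - 1 - u| ≤ |u| ^ 2 * Real.exp |u| := abs_exp_sub_one_sub_le u
      _ ≤ (|δ| * b) ^ 2 * Real.exp b := by gcongr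
      _ = δ ^ 2 * (b ^ 2 * Real.exp b) := by rw [hδ2]; ring
      _ ≤ δ ^ 2 * (2 * Real.exp b * Real.exp b) := by gcongr
      _ = δ ^ 2 * (2 * Real.exp (2 * b)) := by
        rw [mul_assoc, ← Real.exp_add, two_mul b]
  have e : φ * Real.exp u - φ - δ * (z / v * φ) =
      φ * ((Real.exp u - 1 - u) - δ ^ 2 / (2 * v)) := by rw [hu]; ring
  rw [e, abs_mul, abs_of_nonneg hφ, gaussianEnvelope, ← hb]
  calc φ * |Real.exp u - 1 - u - δ ^ 2 / (2 * v)|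
      ≤ φ * (|Real.exp u - 1 - u| + |δ ^ 2 / (2 * v)|) := by gcongr; exact abs_sub _ _
    _ ≤ φ * (δ ^ 2 * (2 * Real.exp (2 * b)) + δ ^ 2 / (2 * v)) := by
        gcongr
        rw [abs_of_nonneg (by positivity)]
    _ = _ := by ring

theorem integrable_scorePDF (μ : ℝ) (v : NNReal) : Integrable (scorePDF μ v) := by
  by_cases hv : v = 0
  · have e : scorePDF μ v = fun _ => (0 : ℝ) := by
      funext a; simp [hv, scorePDF]
    rw [e]
    exact integrable_zero _ _ _
  have h : Integrable (fun a => gaussianPDFReal μ v a * ((a - μ) / v)) := by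
    rw [integrable_gaussianPDFReal_mul_iff hv]
    have : Integrable (fun a : ℝ => a) (gaussianReal μ v) :=
      (memLp_id_gaussianReal (μ := μ) (v := v) 1).integrable (by norm_num)
    exact (this.sub (integrable_const μ)).div_const _
  exact h.congr (ae_of_all _ fun a => mul_comm _ _)

/-- Translation invariance; it makes the Lipschitz constant below independent of the mean. -/
theorem integral_abs_scorePDF (μ : ℝ) (v : NNReal) :
    ∫ a, |scorePDF μ v a| = ∫ a, |scorePDF 0 v a| := by
  rw [← integral_sub_right_eq_self (fun a => |scorePDF 0 v a|) μ]
  simp only [scorePDF, gaussianPDFReal_sub, zero_add, sub_zero]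

theorem Integrable.mul_bdd_real {g f : ℝ → ℝ} (hg : Integrable g) (hf : Measurable f) {B : ℝ}
    (hB : ∀ a, |f a| ≤ B) : Integrable (fun a => g a * f a) :=
  hg.mul_bdd hf.aestronglyMeasurable (ae_of_all _ hB)

/-- Second-order expansion of a Gaussian average in the mean, uniformly over bounded integrands. -/
theorem exists_gaussian_expansion (hv : v ≠ 0) : ∃ C : ℝ, 0 ≤ C ∧
    ∀ (μ δ B : ℝ) (f : ℝ → ℝ), |δ| ≤ 1 → Measurable f → (∀ a, |f a| ≤ B) →
      |(∫ a, gaussianPDFReal (μ + δ) v a * f a) - (∫ a, gaussianPDFReal μ v a * f a) -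
        δ * ∫ a, scorePDF μ v a * f a| ≤ C * B * δ ^ 2 := by
  refine ⟨∫ z, gaussianPDFReal 0 v z * gaussianEnvelope v z, integral_nonneg fun z => ?_, ?_⟩
  · have := gaussianPDFReal_nonneg 0 v z
    simp only [gaussianEnvelope, Pi.zero_apply]
    positivity
  intro μ δ B f hδ hf hB
  have i1 := Integrable.mul_bdd_real (integrable_gaussianPDFReal (μ + δ) v) hf hB
  have i2 := Integrable.mul_bdd_real (integrable_gaussianPDFReal μ v) hf hB
  have i3 := Integrable.mul_bdd_real (integrable_scorePDF μ v) hf hB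
  have hi := (integrable_gaussianPDFReal_mul_envelope hv).comp_sub_right μ
  rw [← integral_const_mul, ← integral_sub i1 i2,
    ← integral_sub (by exact i1.sub i2) (i3.const_mul δ),
    ← integral_sub_right_eq_self (fun z => gaussianPDFReal 0 v z * gaussianEnvelope v z) μ]
  refine (norm_integral_le_of_norm_le (f := fun a => gaussianPDFReal (μ + δ) v a * f a -
    gaussianPDFReal μ v a * f a - δ * (scorePDF μ v a * f a))
    (hi.const_mul (B * δ ^ 2)) (ae_of_all _ fun a => ?_)).trans ?_
  · have e : gaussianPDFReal (μ + δ) v a * f a - gaussianPDFReal μ v a * f a -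
        δ * (scorePDF μ v a * f a) =
        (gaussianPDFReal (μ + δ) v a - gaussianPDFReal μ v a - δ * scorePDF μ v a) * f a := by ring
    rw [e, Real.norm_eq_abs, abs_mul]
    have h1 := abs_gaussianPDFReal_remainder_le hv μ hδ a
    calc _ ≤ (δ ^ 2 * (gaussianPDFReal 0 v (a - μ) * gaussianEnvelope v (a - μ))) * B :=
          mul_le_mul h1 (hB a) (abs_nonneg _) ((abs_nonneg _).trans h1)
      _ = _ := by ring
  · rw [integral_const_mul]
    exact le_of_eq (by ring)

theorem abs_integral_scorePDF_mul_le (μ : ℝ) (v : NNReal) {f : ℝ → ℝ} {B : ℝ}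
    (hB : ∀ a, |f a| ≤ B) :
    |∫ a, scorePDF μ v a * f a| ≤ (∫ a, |scorePDF 0 v a|) * B := by
  rw [← integral_abs_scorePDF μ, ← integral_mul_const]
  refine norm_integral_le_of_norm_le (f := fun a => scorePDF μ v a * f a)
    ((integrable_scorePDF μ v).abs.mul_const B) (ae_of_all _ fun a => ?_)
  rw [Real.norm_eq_abs, abs_mul]
  exact mul_le_mul_of_nonneg_left (hB a) (abs_nonneg _)

/-- Lipschitz dependence of a Gaussian average on the mean, uniformly over bounded integrands. -/
theorem exists_gaussian_lipschitz (hv : v ≠ 0) : ∃ C : ℝ, 0 ≤ C ∧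
    ∀ (μ δ B : ℝ) (f : ℝ → ℝ), |δ| ≤ 1 → Measurable f → (∀ a, |f a| ≤ B) →
      |(∫ a, gaussianPDFReal (μ + δ) v a * f a) - (∫ a, gaussianPDFReal μ v a * f a)| ≤
        C * B * |δ| := by
  obtain ⟨C, hC0, hC⟩ := exists_gaussian_expansion hv
  have hs : 0 ≤ ∫ a, |scorePDF 0 v a| := integral_nonneg fun _ => abs_nonneg _
  refine ⟨C + ∫ a, |scorePDF 0 v a|, by positivity, fun μ δ B f hδ hf hB => ?_⟩
  have hB0 : 0 ≤ B := (abs_nonneg _).trans (hB 0)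
  have h1 := hC μ δ B f hδ hf hB
  have h2 := abs_integral_scorePDF_mul_le μ v hB
  have h3 : |δ * ∫ a, scorePDF μ v a * f a| ≤ |δ| * ((∫ a, |scorePDF 0 v a|) * B) := by
    rw [abs_mul]; gcongr
  have h4 : C * B * δ ^ 2 ≤ C * B * |δ| := by
    rw [← sq_abs]
    have := abs_nonneg δ
    gcongr
    nlinarith
  have h5 := abs_add_le
    ((∫ a, gaussianPDFReal (μ + δ) v a * f a) - (∫ a, gaussianPDFReal μ v a * f a) -
        δ * ∫ a, scorePDF μ v a * f a) (δ * ∫ a, scorePDF μ v a * f a)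
  rw [sub_add_cancel] at h5
  linarith

theorem abs_integral_gaussianPDFReal_mul_le (hv : v ≠ 0) (μ : ℝ) {f : ℝ → ℝ} {B : ℝ}
    (hB : ∀ a, |f a| ≤ B) : |∫ a, gaussianPDFReal μ v a * f a| ≤ B := by
  have h := norm_integral_le_of_norm_le ((integrable_gaussianPDFReal μ v).mul_const B)
    (f := fun a => gaussianPDFReal μ v a * f a) (ae_of_all _ fun a => by
      rw [Real.norm_eq_abs, abs_mul, abs_of_nonneg (gaussianPDFReal_nonneg μ v a)]
      exact mul_le_mul_of_nonneg_left (hB a) (gaussianPDFReal_nonneg μ v a))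
  rwa [integral_mul_const, integral_gaussianPDFReal_eq_one μ hv, one_mul] at h

variable {X : Type*} [TopologicalSpace X] [FirstCountableTopology X]

/-- Two sources of variation are separated: with the mean frozen at `m x₀`, dominated convergence
handles the integrand, and the Lipschitz bound, uniform in the integrand, handles the mean. -/
theorem continuous_integral_gaussianPDFReal_mul (hv : v ≠ 0) {m : X → ℝ} (hm : Continuous m)
    {F : X → ℝ → ℝ} (hF : ∀ x, Measurable (F x)) (hFc : ∀ a, Continuous fun x => F x a) {B : ℝ}
    (hB : ∀ x a, |F x a| ≤ B) :
    Continuous fun x => ∫ a, gaussianPDFReal (m x) v a * F x a := by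
  obtain ⟨C, -, hC⟩ := exists_gaussian_lipschitz hv
  rw [continuous_iff_continuousAt]
  intro x₀
  have h1 : Tendsto (fun x => ∫ a, gaussianPDFReal (m x₀) v a * F x a) (𝓝 x₀)
      (𝓝 (∫ a, gaussianPDFReal (m x₀) v a * F x₀ a)) := by
    refine tendsto_integral_filter_of_dominated_convergence
      (fun a => gaussianPDFReal (m x₀) v a * B) ?_ ?_
      ((integrable_gaussianPDFReal _ v).mul_const B) ?_
    · exact Eventually.of_forall fun x =>
        ((measurable_gaussianPDFReal _ v).mul (hF x)).aestronglyMeasurable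
    · refine Eventually.of_forall fun x => ae_of_all _ fun a => ?_
      rw [Real.norm_eq_abs, abs_mul, abs_of_nonneg (gaussianPDFReal_nonneg _ v a)]
      exact mul_le_mul_of_nonneg_left (hB x a) (gaussianPDFReal_nonneg _ v a)
    · exact ae_of_all _ fun a => ((hFc a).tendsto x₀).const_mul _
  have h2 : Tendsto (fun x => (∫ a, gaussianPDFReal (m x) v a * F x a) -
      ∫ a, gaussianPDFReal (m x₀) v a * F x a) (𝓝 x₀) (𝓝 0) := by
    have hd : Tendsto (fun x => |m x - m x₀|) (𝓝 x₀) (𝓝 0) := by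
      have := ((hm.sub continuous_const).abs : Continuous fun x => |m x - m x₀|).tendsto x₀
      simpa using this
    refine squeeze_zero_norm' ?_ (by simpa using hd.const_mul (C * B))
    filter_upwards [hd.eventually (gt_mem_nhds one_pos)] with x hx
    have := hC (m x₀) (m x - m x₀) B (F x) hx.le (hF x) (hB x)
    rwa [add_sub_cancel] at this
  simpa [ContinuousAt] using h2.add h1

/-- The score average is the uniform limit of difference quotients in the mean with step `1 / (j +
1)`. Each quotient is continuous, and the second-order expansion bounds the error by `C * B / (j +
1)`. -/
theorem continuous_integral_scorePDF_mul (hv : v ≠ 0) {m : X → ℝ} (hm : Continuous m)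
    {F : X → ℝ → ℝ} (hF : ∀ x, Measurable (F x)) (hFc : ∀ a, Continuous fun x => F x a) {B : ℝ}
    (hB : ∀ x a, |F x a| ≤ B) :
    Continuous fun x => ∫ a, scorePDF (m x) v a * F x a := by
  obtain ⟨C, hC0, hC⟩ := exists_gaussian_expansion hv
  have hu : TendstoUniformly (fun (j : ℕ) x => ((j : ℝ) + 1) *
      ((∫ a, gaussianPDFReal (m x + 1 / ((j : ℝ) + 1)) v a * F x a) -
        ∫ a, gaussianPDFReal (m x) v a * F x a))
      (fun x => ∫ a, scorePDF (m x) v a * F x a) atTop := by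
    rw [Metric.tendstoUniformly_iff]
    intro ε hε
    have ht : Tendsto (fun j : ℕ => C * B * (1 / ((j : ℝ) + 1))) atTop (𝓝 0) := by
      simpa using tendsto_one_div_add_atTop_nhds_zero_nat.const_mul (C * B)
    filter_upwards [ht.eventually (gt_mem_nhds hε)] with j hj x
    refine lt_of_le_of_lt ?_ hj
    have hj0 : (0 : ℝ) < (j : ℝ) + 1 := by positivity
    have hd : |1 / ((j : ℝ) + 1)| ≤ 1 := by
      rw [abs_of_pos (by positivity), div_le_one hj0]
      linarith [Nat.cast_nonneg (α := ℝ) j]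
    have h := mul_le_mul_of_nonneg_left (hC (m x) _ B (F x) hd (hF x) (hB x)) hj0.le
    rw [dist_comm, Real.dist_eq]
    have e : ∀ A D : ℝ, ((j : ℝ) + 1) * A - D = ((j : ℝ) + 1) * (A - 1 / ((j : ℝ) + 1) * D) := by
      intro A D; field_simp
    rw [e, abs_mul, abs_of_pos hj0]
    refine h.trans (le_of_eq ?_)
    field_simp
  refine hu.continuous (Eventually.of_forall fun j => ?_).frequently
  exact continuous_const.mul
    ((continuous_integral_gaussianPDFReal_mul hv (hm.add continuous_const) hF hFc hB).sub
      (continuous_integral_gaussianPDFReal_mul hv hm hF hFc hB))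

end Gaussian

end OnlinePG

/-! ### The transition operator on continuous functions and the state densities. -/

namespace OnlinePG

open Filter Topology

variable {n : ℕ} {S : TopologicalSpace.Compacts (EuclideanSpace ℝ (Fin n))}

/-- The boundedness and continuity assumptions on a Markov decision process. -/
structure MDP.IsRegular (M : MDP S) : Prop where
  p_bdd : ∃ B : ℝ, ∀ s a s', M.p s a s' ≤ B
  p_cont : ∀ a : ℝ, Continuous fun x : S × S => M.p x.1 a x.2
  r_bdd : ∃ B : ℝ, ∀ s a, |M.r s a| ≤ B
  r_cont : ∀ a : ℝ, Continuous fun s : S => M.r s a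

/-- Bounded measurable functions of a state and an action that are continuous in the state. -/
structure IsActionFunction (F : S → ℝ → ℝ) : Prop where
  measurable : Measurable fun x : S × ℝ => F x.1 x.2
  continuous : ∀ a, Continuous fun s => F s a
  bdd : ∃ B : ℝ, ∀ s a, |F s a| ≤ B

theorem IsActionFunction.measurable_right {F : S → ℝ → ℝ} (hF : IsActionFunction F) (s : S) :
    Measurable (F s) :=
  hF.measurable.comp (measurable_const.prodMk measurable_id)

theorem IsActionFunction.add {F G : S → ℝ → ℝ} (hF : IsActionFunction F)
    (hG : IsActionFunction G) : IsActionFunction fun s a => F s a + G s a where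
  measurable := hF.measurable.add hG.measurable
  continuous a := (hF.continuous a).add (hG.continuous a)
  bdd := by
    obtain ⟨B, hB⟩ := hF.bdd
    obtain ⟨C, hC⟩ := hG.bdd
    exact ⟨B + C, fun s a => (abs_add_le _ _).trans (add_le_add (hB s a) (hC s a))⟩

theorem IsActionFunction.const_mul {F : S → ℝ → ℝ} (hF : IsActionFunction F) (c : ℝ) :
    IsActionFunction fun s a => c * F s a where
  measurable := hF.measurable.const_mul c
  continuous a := continuous_const.mul (hF.continuous a)
  bdd := by
    obtain ⟨B, hB⟩ := hF.bdd
    refine ⟨|c| * B, fun s a => ?_⟩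
    rw [abs_mul]
    exact mul_le_mul_of_nonneg_left (hB s a) (abs_nonneg _)

theorem MDP.IsRegular.isActionFunction_r {M : MDP S} (hM : M.IsRegular) : IsActionFunction M.r :=
  ⟨M.r_measurable, hM.r_cont, hM.r_bdd⟩

/-- The average of `F s` over the Gaussian policy, as a continuous function of the state. -/
noncomputable def actionMean {v : NNReal} (hv : v ≠ 0) (m : C(S, ℝ)) {F : S → ℝ → ℝ}
    (hF : IsActionFunction F) : C(S, ℝ) :=
  ⟨fun s => ∫ a, gaussianPDFReal (m s) v a * F s a,
    continuous_integral_gaussianPDFReal_mul hv m.continuous hF.measurable_right hF.continuous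
      hF.bdd.choose_spec⟩

/-- The average of `F s` against the score of the Gaussian policy. -/
noncomputable def scoreMean {v : NNReal} (hv : v ≠ 0) (m : C(S, ℝ)) {F : S → ℝ → ℝ}
    (hF : IsActionFunction F) : C(S, ℝ) :=
  ⟨fun s => ∫ a, scorePDF (m s) v a * F s a,
    continuous_integral_scorePDF_mul hv m.continuous hF.measurable_right hF.continuous
      hF.bdd.choose_spec⟩

theorem MDP.integrable_p (M : MDP S) (s : S) (a : ℝ) : Integrable (M.p s a) := by
  by_contra h
  have := M.p_integral s a
  rw [integral_undef h] at this
  exact zero_ne_one this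

theorem MDP.p_measurable_right (M : MDP S) (s : S) (a : ℝ) : Measurable (M.p s a) :=
  M.p_measurable.comp (g := fun x : (S × ℝ) × S => M.p x.1.1 x.1.2 x.2)
    (measurable_prodMk_left (x := (s, a)))

/-- The conditional mean of `f` at the next state. -/
noncomputable def MDP.lookahead (M : MDP S) (f : S → ℝ) (s : S) (a : ℝ) : ℝ :=
  ∫ s', M.p s a s' * f s'

theorem MDP.integrable_p_mul (M : MDP S) (s : S) (a : ℝ) {f : S → ℝ} (hf : Measurable f) {B : ℝ}
    (hB : ∀ s, |f s| ≤ B) : Integrable fun s' => M.p s a s' * f s' :=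
  (M.integrable_p s a).mul_bdd hf.aestronglyMeasurable (ae_of_all _ hB)

theorem MDP.abs_lookahead_le (M : MDP S) {f : S → ℝ} {B : ℝ} (hB : ∀ s, |f s| ≤ B) (s : S)
    (a : ℝ) : |M.lookahead f s a| ≤ B := by
  have h := norm_integral_le_of_norm_le ((M.integrable_p s a).mul_const B)
    (f := fun s' => M.p s a s' * f s') (ae_of_all _ fun s' => by
      rw [Real.norm_eq_abs, abs_mul, abs_of_nonneg (M.p_nonneg s a s')]
      exact mul_le_mul_of_nonneg_left (hB s') (M.p_nonneg s a s'))
  rwa [integral_mul_const, M.p_integral, one_mul] at h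

theorem MDP.measurable_lookahead (M : MDP S) {f : S → ℝ} (hf : Measurable f) :
    Measurable fun x : S × ℝ => M.lookahead f x.1 x.2 := by
  have h : StronglyMeasurable fun x : (S × ℝ) × S => M.p x.1.1 x.1.2 x.2 * f x.2 :=
    (M.p_measurable.mul (hf.comp measurable_snd)).stronglyMeasurable
  exact h.integral_prod_right'.measurable

theorem MDP.IsRegular.isActionFunction_lookahead {M : MDP S} (hM : M.IsRegular) (f : C(S, ℝ)) :
    IsActionFunction (M.lookahead f) where
  measurable := M.measurable_lookahead f.continuous.measurable
  continuous a := by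
    obtain ⟨B, hB⟩ := hM.p_bdd
    refine continuous_of_dominated (bound := fun _ => B * ‖f‖)
      (fun s => ((M.p_measurable_right s a).mul f.continuous.measurable).aestronglyMeasurable)
      (fun s => ae_of_all _ fun s' => ?_) (integrable_const _) (ae_of_all _ fun s' => ?_)
    · rw [Real.norm_eq_abs, abs_mul, abs_of_nonneg (M.p_nonneg s a s')]
      exact mul_le_mul (hB s a s') (f.norm_coe_le_norm s') (abs_nonneg _)
        ((M.p_nonneg s a s').trans (hB s a s'))
    · exact ((hM.p_cont a).comp (Continuous.prodMk_left s')).mul continuous_const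
  bdd := ⟨‖f‖, M.abs_lookahead_le f.norm_coe_le_norm⟩

theorem MDP.lookahead_add (M : MDP S) (f g : C(S, ℝ)) (s : S) (a : ℝ) :
    M.lookahead (f + g : C(S, ℝ)) s a = M.lookahead f s a + M.lookahead g s a := by
  rw [lookahead, lookahead, lookahead, ← integral_add
    (M.integrable_p_mul s a f.continuous.measurable f.norm_coe_le_norm)
    (M.integrable_p_mul s a g.continuous.measurable g.norm_coe_le_norm)]
  simp only [ContinuousMap.add_apply, mul_add]

theorem MDP.lookahead_smul (M : MDP S) (c : ℝ) (f : C(S, ℝ)) (s : S) (a : ℝ) :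
    M.lookahead (c • f : C(S, ℝ)) s a = c * M.lookahead f s a := by
  rw [lookahead, lookahead, ← integral_const_mul]
  simp only [ContinuousMap.smul_apply, smul_eq_mul, mul_left_comm]

theorem integrable_gaussianPDFReal_mul {F : S → ℝ → ℝ} (hF : IsActionFunction F) (μ : ℝ)
    (v : NNReal) (s : S) : Integrable fun a => gaussianPDFReal μ v a * F s a :=
  Integrable.mul_bdd_real (integrable_gaussianPDFReal μ v) (hF.measurable_right s)
    (hF.bdd.choose_spec s)

variable {M : MDP S} {v : NNReal}

/-- The transition operator on continuous functions under a Gaussian policy. -/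
noncomputable def MDP.IsRegular.transitionOp (hM : M.IsRegular) (hv : v ≠ 0) (m : C(S, ℝ)) :
    C(S, ℝ) →L[ℝ] C(S, ℝ) :=
  LinearMap.mkContinuous
    { toFun := fun f => actionMean hv m (hM.isActionFunction_lookahead f)
      map_add' := fun f g => by
        ext s
        simp only [actionMean, ContinuousMap.coe_mk, ContinuousMap.add_apply, M.lookahead_add,
          mul_add]
        exact integral_add
          (integrable_gaussianPDFReal_mul (hM.isActionFunction_lookahead f) _ v s)
          (integrable_gaussianPDFReal_mul (hM.isActionFunction_lookahead g) _ v s)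
      map_smul' := fun c f => by
        ext s
        simp only [actionMean, ContinuousMap.coe_mk, ContinuousMap.smul_apply, M.lookahead_smul,
          mul_left_comm, integral_const_mul, RingHom.id_apply, smul_eq_mul] }
    1 fun f => by
      rw [one_mul, ContinuousMap.norm_le _ (norm_nonneg _)]
      exact fun s => abs_integral_gaussianPDFReal_mul_le hv _
        (M.abs_lookahead_le f.norm_coe_le_norm s)

theorem MDP.IsRegular.transitionOp_apply (hM : M.IsRegular) (hv : v ≠ 0) (m f : C(S, ℝ)) (s : S) :
    hM.transitionOp hv m f s = ∫ a, gaussianPDFReal (m s) v a * M.lookahead f s a := rfl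

theorem MDP.IsRegular.norm_transitionOp_le (hM : M.IsRegular) (hv : v ≠ 0) (m : C(S, ℝ)) :
    ‖hM.transitionOp hv m‖ ≤ 1 :=
  LinearMap.mkContinuous_norm_le _ zero_le_one _

theorem MDP.IsRegular.continuous_stepDensity (hM : M.IsRegular) (hv : v ≠ 0) (m : C(S, ℝ)) :
    Continuous fun x : S × S => M.stepDensity v m x.1 x.2 := by
  obtain ⟨B, hB⟩ := hM.p_bdd
  refine continuous_integral_gaussianPDFReal_mul (X := S × S) hv
    (m := fun x => m x.1) (F := fun x a => M.p x.1 a x.2) (B := B) (by fun_prop) (fun x => ?_)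
    hM.p_cont fun x a => ?_
  · exact M.p_measurable.comp
      (((measurable_const (a := x.1)).prodMk measurable_id).prodMk measurable_const)
  · rw [abs_of_nonneg (M.p_nonneg _ _ _)]
    exact hB _ _ _

theorem MDP.stepDensity_nonneg (M : MDP S) (v : NNReal) (m : C(S, ℝ)) (s s' : S) :
    0 ≤ M.stepDensity v m s s' :=
  integral_nonneg fun _ => mul_nonneg (gaussianPDFReal_nonneg _ _ _) (M.p_nonneg _ _ _)

theorem MDP.stepDensity_le (M : MDP S) (hv : v ≠ 0) (m : C(S, ℝ)) {B : ℝ}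
    (hB : ∀ s a s', M.p s a s' ≤ B) (s s' : S) : M.stepDensity v m s s' ≤ B :=
  (le_abs_self _).trans <| abs_integral_gaussianPDFReal_mul_le hv _ fun a => by
    rw [abs_of_nonneg (M.p_nonneg _ _ _)]
    exact hB _ _ _

theorem MDP.IsRegular.transitionOp_eq_stepDensity (hM : M.IsRegular) (hv : v ≠ 0) (m f : C(S, ℝ)) (s : S) :
    hM.transitionOp hv m f s = ∫ s', M.stepDensity v m s s' * f s' := by
  obtain ⟨B, hB⟩ := hM.p_bdd
  have hi : Integrable (Function.uncurry fun (a : ℝ) (s' : S) =>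
      gaussianPDFReal (m s) v a * (M.p s a s' * f s')) (volume.prod volume) := by
    have h1 : Integrable (fun x : ℝ × S => gaussianPDFReal (m s) v x.1 * (1 : ℝ))
        (volume.prod volume) :=
      (integrable_gaussianPDFReal (m s) v).mul_prod (integrable_const (1 : ℝ))
    simp only [mul_one] at h1
    have hmeas : Measurable fun x : ℝ × S => M.p s x.1 x.2 * f x.2 :=
      (M.p_measurable.comp ((measurable_const.prodMk measurable_fst).prodMk measurable_snd)).mul
        (f.continuous.measurable.comp measurable_snd)
    refine h1.mul_bdd (c := B * ‖f‖) hmeas.aestronglyMeasurable (ae_of_all _ fun x => ?_)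
    rw [Real.norm_eq_abs, abs_mul, abs_of_nonneg (M.p_nonneg _ _ _)]
    exact mul_le_mul (hB _ _ _) (f.norm_coe_le_norm _) (abs_nonneg _)
      ((M.p_nonneg _ _ _).trans (hB s x.1 x.2))
  -- The action and the next state are integrated in the opposite order; boundedness of `p` and
  -- finiteness of the volume of `S` give the integrability.
  rw [hM.transitionOp_apply]
  simp only [MDP.lookahead, MDP.stepDensity, ← integral_const_mul, ← integral_mul_const]
  rw [integral_integral_swap hi]
  simp only [mul_assoc]

theorem MDP.IsRegular.integral_stepDensity (hM : M.IsRegular) (hv : v ≠ 0) (m : C(S, ℝ)) (s : S) :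
    ∫ s', M.stepDensity v m s s' = 1 := by
  have h := hM.transitionOp_eq_stepDensity hv m 1 s
  simp only [ContinuousMap.one_apply, mul_one] at h
  rw [← h, hM.transitionOp_apply]
  simp only [MDP.lookahead, ContinuousMap.one_apply, mul_one, M.p_integral]
  exact integral_gaussianPDFReal_eq_one _ hv

theorem MDP.stateDensity_nonneg (M : MDP S) (v : NNReal) (m : C(S, ℝ)) :
    ∀ (t : ℕ) (s s' : S), 0 ≤ M.stateDensity v m t s s'
  | 0, s, s' => M.stepDensity_nonneg v m s s'
  | t + 1, s, _ => integral_nonneg fun x =>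
      mul_nonneg (M.stateDensity_nonneg v m t s x) (M.stepDensity_nonneg v m x _)

/-- The state densities are continuous in the state, and their integral against a continuous
function is given by a power of the transition operator. -/
theorem MDP.IsRegular.stateDensity_spec (hM : M.IsRegular) (hv : v ≠ 0)
    (m : C(S, ℝ)) (t : ℕ) (s : S) :
    Continuous (M.stateDensity v m t s) ∧ ∀ f : C(S, ℝ),
      ∫ x, M.stateDensity v m t s x * f x = (hM.transitionOp hv m ^ (t + 1)) f s := by
  have hstep := hM.continuous_stepDensity hv m
  induction t with
  | zero =>
    have h0 : Continuous fun x => M.stepDensity v m s x :=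
      hstep.comp' (f := fun x : S => (s, x)) (by fun_prop)
    refine ⟨h0, fun f => ?_⟩
    rw [zero_add, pow_one, hM.transitionOp_eq_stepDensity]
    rfl
  | succ t ih =>
    obtain ⟨hc, hint⟩ := ih
    have hstep' : Continuous fun z : S × S => M.stepDensity v m z.2 z.1 :=
      hstep.comp' (f := fun z : S × S => (z.2, z.1)) (by fun_prop)
    have hcont : Continuous fun z : S × S =>
        M.stateDensity v m t s z.2 * M.stepDensity v m z.2 z.1 :=
      (hc.comp' continuous_snd).mul hstep'
    refine ⟨?_, fun f => ?_⟩
    · have := continuousOn_integral_of_compact_support (μ := (volume : Measure S)) isCompact_univ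
        (f := fun x' x => M.stateDensity v m t s x * M.stepDensity v m x x')
        (s := Set.univ) hcont.continuousOn (fun _ x _ hx => absurd (Set.mem_univ x) hx)
      exact continuousOn_univ.1 this
    · have e : ∀ x, M.stateDensity v m (t + 1) s x * f x =
          ∫ y, M.stateDensity v m t s y * M.stepDensity v m y x * f x := fun x => by
        rw [integral_mul_const]; rfl
      have hi : Continuous fun z : S × S =>
          M.stateDensity v m t s z.2 * M.stepDensity v m z.2 z.1 * f z.1 :=
        hcont.mul (f.continuous.comp' continuous_fst)
      simp only [e]
      rw [integral_integral_swap (hi.integrable_of_hasCompactSupport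
        (HasCompactSupport.of_compactSpace _))]
      simp only [mul_assoc, integral_const_mul]
      -- The last step of the chain acts on `f` first; the induction hypothesis applies to the
      -- resulting continuous function.
      rw [pow_succ, mul_apply_eq_comp, ← hint]
      simp only [hM.transitionOp_eq_stepDensity]

theorem MDP.IsRegular.continuous_stateDensity (hM : M.IsRegular) (hv : v ≠ 0)
    (m : C(S, ℝ)) (t : ℕ) (s : S) :
    Continuous (M.stateDensity v m t s) :=
  (hM.stateDensity_spec hv m t s).1

theorem MDP.IsRegular.integral_stateDensity_mul (hM : M.IsRegular) (hv : v ≠ 0)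
    (m : C(S, ℝ)) (t : ℕ) (s : S) (f : C(S, ℝ)) :
    ∫ x, M.stateDensity v m t s x * f x = (hM.transitionOp hv m ^ (t + 1)) f s :=
  (hM.stateDensity_spec hv m t s).2 f

theorem MDP.IsRegular.transitionOp_one (hM : M.IsRegular) (hv : v ≠ 0) (m : C(S, ℝ)) :
    hM.transitionOp hv m 1 = 1 := by
  ext s
  rw [hM.transitionOp_eq_stepDensity]
  simpa using hM.integral_stepDensity hv m s

theorem MDP.IsRegular.integral_stateDensity (hM : M.IsRegular) (hv : v ≠ 0)
    (m : C(S, ℝ)) (t : ℕ) (s : S) :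
    ∫ x, M.stateDensity v m t s x = 1 := by
  have h := hM.integral_stateDensity_mul hv m t s 1
  have hpow : ∀ k : ℕ, (hM.transitionOp hv m ^ k) 1 = 1 := fun k => by
    induction k with
    | zero => rfl
    | succ k ih => rw [pow_succ, mul_apply_eq_comp, hM.transitionOp_one, ih]
  simpa [hpow] using h

/-- Each later density averages one-step densities against a probability density, so one bound
serves all times and the discounted series converges. -/
theorem MDP.IsRegular.stateDensity_le (hM : M.IsRegular) (hv : v ≠ 0) (m : C(S, ℝ)) {B : ℝ}
    (hB : ∀ s a s', M.p s a s' ≤ B) (t : ℕ) (s x : S) : M.stateDensity v m t s x ≤ B := by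
  cases t with
  | zero => exact M.stepDensity_le hv m hB s x
  | succ t =>
    have hi : Integrable (M.stateDensity v m t s) :=
      (hM.continuous_stateDensity hv m t s).integrable_of_hasCompactSupport
        (HasCompactSupport.of_compactSpace _)
    have h := norm_integral_le_of_norm_le (hi.mul_const B)
      (f := fun y => M.stateDensity v m t s y * M.stepDensity v m y x) (ae_of_all _ fun y => by
        rw [Real.norm_eq_abs, abs_mul, abs_of_nonneg (M.stateDensity_nonneg v m t s y),
          abs_of_nonneg (M.stepDensity_nonneg v m y x)]
        exact mul_le_mul_of_nonneg_left (M.stepDensity_le hv m hB y x)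
          (M.stateDensity_nonneg v m t s y))
    rw [integral_mul_const, hM.integral_stateDensity hv, one_mul] at h
    exact (le_abs_self _).trans h

end OnlinePG

/-! ### The value as a resolvent, and the discounted state density. -/

namespace OnlinePG

open Filter Topology

variable {n : ℕ} {S : TopologicalSpace.Compacts (EuclideanSpace ℝ (Fin n))}
variable {M : MDP S} {v : NNReal}

theorem MDP.integral_transition (M : MDP S) (x : S × ℝ) (g : S → ℝ) :
    ∫ s', g s' ∂(M.transition x) = M.lookahead g x.1 x.2 := by
  have hm : Measurable (Function.uncurry
      fun (x : S × ℝ) (s' : S) => ENNReal.ofReal (M.p x.1 x.2 s')) :=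
    M.p_measurable.ennreal_ofReal
  rw [MDP.transition, Kernel.withDensity_apply _ hm, Kernel.const_apply,
    integral_withDensity_eq_integral_toReal_smul (M.p_measurable_right _ _).ennreal_ofReal
      (ae_of_all _ fun _ => ENNReal.ofReal_lt_top), MDP.lookahead]
  simp only [ENNReal.toReal_ofReal (M.p_nonneg _ _ _), smul_eq_mul]

theorem integrable_of_isActionFunction {F : S → ℝ → ℝ} (hF : IsActionFunction F)
    (μ : Measure (S × ℝ)) [IsFiniteMeasure μ] : Integrable (fun x => F x.1 x.2) μ :=
  Integrable.of_bound hF.measurable.aestronglyMeasurable hF.bdd.choose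
    (ae_of_all _ fun x => hF.bdd.choose_spec x.1 x.2)

theorem integral_gaussianPolicy (hv : v ≠ 0) (m : C(S, ℝ)) {F : S → ℝ → ℝ}
    (hF : IsActionFunction F) (s : S) :
    ∫ a, F s a ∂(gaussianPolicy v m s) = actionMean hv m hF s :=
  integral_gaussianReal_eq_integral_smul hv

theorem MDP.integral_step (M : MDP S) (hv : v ≠ 0) (m : C(S, ℝ)) {F : S → ℝ → ℝ}
    (hF : IsActionFunction F) (x : S × ℝ) :
    ∫ y, F y.1 y.2 ∂(M.step (gaussianPolicy v m) x) =
      M.lookahead (actionMean hv m hF) x.1 x.2 := by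
  rw [← M.integral_transition x]
  have h := ProbabilityTheory.integral_compProd (κ := M.transition)
    (η := Kernel.prodMkLeft (S × ℝ) (gaussianPolicy v m)) (a := x)
    (f := fun y : S × ℝ => F y.1 y.2) (integrable_of_isActionFunction hF _)
  refine h.trans (integral_congr_ae (ae_of_all _ fun s' => ?_))
  exact integral_gaussianPolicy hv m hF s'

instance instIsProbabilityMeasureInitialLaw (π : Kernel S ℝ) [IsMarkovKernel π] (s₀ : S) :
    IsProbabilityMeasure ((π s₀).map fun a => (s₀, a)) :=
  Measure.isProbabilityMeasure_map (by fun_prop)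

instance instIsProbabilityMeasureTrajectoryLaw (M : MDP S) (π : Kernel S ℝ) [IsMarkovKernel π]
    (s₀ : S) : IsProbabilityMeasure (M.trajectoryLaw π s₀) :=
  inferInstanceAs (IsProbabilityMeasure (Kernel.trajMeasure (X := fun _ => S × ℝ) _ _))

theorem MDP.trajectoryLaw_map_zero (M : MDP S) (π : Kernel S ℝ) [IsMarkovKernel π] (s₀ : S) :
    (M.trajectoryLaw π s₀).map (fun ω => ω 0) = (π s₀).map fun a => (s₀, a) := by
  have h : (M.trajectoryLaw π s₀).map (Preorder.frestrictLe 0) =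
      ((π s₀).map fun a => (s₀, a)).map (MeasurableEquiv.piUnique
        (fun _ : Finset.Iic 0 => S × ℝ)).symm := by
    rw [MDP.trajectoryLaw, Kernel.trajMeasure, Measure.map_comp _ _ (by fun_prop),
      Kernel.traj_map_frestrictLe, Kernel.partialTraj_self]
    exact Measure.id_comp
  have e : (fun ω : ℕ → S × ℝ => ω 0) =
      MeasurableEquiv.piUnique (fun _ : Finset.Iic 0 => S × ℝ) ∘ Preorder.frestrictLe 0 := rfl
  rw [e, ← Measure.map_map (MeasurableEquiv.measurable _) (by fun_prop), h,
    Measure.map_map (MeasurableEquiv.measurable _) (MeasurableEquiv.measurable _),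
    MeasurableEquiv.self_comp_symm, Measure.map_id]

/-- The Markov property: the joint law of the history and the next pair disintegrates through
`historyStep`, which reads only the last coordinate of the history. -/
theorem MDP.integral_trajectoryLaw_succ (M : MDP S) (hv : v ≠ 0) (m : C(S, ℝ)) {F : S → ℝ → ℝ}
    (hF : IsActionFunction F) (s₀ : S) (t : ℕ) :
    ∫ ω, F (ω (t + 1)).1 (ω (t + 1)).2 ∂(M.trajectoryLaw (gaussianPolicy v m) s₀) =
      ∫ ω, M.lookahead (actionMean hv m hF) (ω t).1 (ω t).2
        ∂(M.trajectoryLaw (gaussianPolicy v m) s₀) := by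
  set π := gaussianPolicy v m
  set P := M.trajectoryLaw π s₀ with hP
  have h : P.map (Preorder.frestrictLe t) ⊗ₘ M.historyStep π t =
      P.map (fun x => (Preorder.frestrictLe t x, x (t + 1))) :=
    Kernel.map_frestrictLe_trajMeasure_compProd_eq_map_trajMeasure
  have : IsProbabilityMeasure (P.map (Preorder.frestrictLe t)) :=
    Measure.isProbabilityMeasure_map (by fun_prop)
  have hm : Measurable fun y : ((_ : Finset.Iic t) → S × ℝ) × (S × ℝ) => F y.2.1 y.2.2 :=
    hF.measurable.comp measurable_snd
  have hi : Integrable (fun y : ((_ : Finset.Iic t) → S × ℝ) × (S × ℝ) => F y.2.1 y.2.2)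
      (P.map (Preorder.frestrictLe t) ⊗ₘ M.historyStep π t) :=
    Integrable.of_bound hm.aestronglyMeasurable hF.bdd.choose
      (ae_of_all _ fun y => hF.bdd.choose_spec y.2.1 y.2.2)
  have h1 := Measure.integral_compProd hi
  rw [h, integral_map (by fun_prop) hm.aestronglyMeasurable] at h1
  refine h1.trans ?_
  have e : ∀ ω : (_ : Finset.Iic t) → S × ℝ,
      ∫ y, F y.1 y.2 ∂(M.historyStep π t ω) =
        M.lookahead (actionMean hv m hF) (ω ⟨t, Finset.mem_Iic.2 le_rfl⟩).1
          (ω ⟨t, Finset.mem_Iic.2 le_rfl⟩).2 := fun ω => M.integral_step hv m hF _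
  simp only [e]
  refine integral_map (by fun_prop) (Measurable.aestronglyMeasurable ?_)
  exact (M.measurable_lookahead (actionMean hv m hF).continuous.measurable).comp
    (measurable_pi_apply _)

/-- `F` is quantified inside the induction because each step back in time replaces it by the
lookahead of its action mean. -/
theorem MDP.IsRegular.integral_trajectoryLaw (hM : M.IsRegular) (hv : v ≠ 0) (m : C(S, ℝ))
    (s₀ : S) (t : ℕ) : ∀ {F : S → ℝ → ℝ} (hF : IsActionFunction F),
      ∫ ω, F (ω t).1 (ω t).2 ∂(M.trajectoryLaw (gaussianPolicy v m) s₀) =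
        (hM.transitionOp hv m ^ t) (actionMean hv m hF) s₀ := by
  induction t with
  | zero =>
    intro F hF
    have h := integral_map (μ := M.trajectoryLaw (gaussianPolicy v m) s₀)
      (φ := fun ω : ℕ → S × ℝ => ω 0) (measurable_pi_apply 0).aemeasurable
      (f := fun y : S × ℝ => F y.1 y.2) hF.measurable.aestronglyMeasurable
    rw [M.trajectoryLaw_map_zero, integral_map (by fun_prop)
      hF.measurable.aestronglyMeasurable] at h
    rw [← h, pow_zero]
    exact integral_gaussianPolicy hv m hF s₀
  | succ t ih =>
    intro F hF
    rw [M.integral_trajectoryLaw_succ hv m hF, ih (hM.isActionFunction_lookahead _), pow_succ]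
    rfl

theorem MDP.IsRegular.norm_discounted_lt_one (hM : M.IsRegular) (hv : v ≠ 0) (m : C(S, ℝ)) {γ : ℝ}
    (hγ₀ : 0 < γ) (hγ₁ : γ < 1) : ‖γ • hM.transitionOp hv m‖ < 1 := by
  refine (ContinuousLinearMap.opNorm_smul_le γ (hM.transitionOp hv m)).trans_lt ?_
  rw [Real.norm_of_nonneg hγ₀.le]
  exact (mul_le_of_le_one_right hγ₀.le (hM.norm_transitionOp_le hv m)).trans_lt hγ₁

theorem clm_smul_pow_apply {X : Type*} [NormedAddCommGroup X] [NormedSpace ℝ X] (c : ℝ)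
    (T : X →L[ℝ] X) (t : ℕ) (x : X) : ((c • T) ^ t) x = c ^ t • (T ^ t) x := by
  rw [smul_pow]
  rfl

/-- The resolvent `∑ₜ γᵗ Pᵗ` of the transition operator. -/
noncomputable def MDP.IsRegular.resolvent (hM : M.IsRegular) (hv : v ≠ 0) (γ : ℝ) (m : C(S, ℝ)) :
    C(S, ℝ) →L[ℝ] C(S, ℝ) :=
  Ring.inverse (1 - γ • hM.transitionOp hv m)

theorem MDP.IsRegular.hasSum_resolvent (hM : M.IsRegular) (hv : v ≠ 0) (m : C(S, ℝ)) {γ : ℝ}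
    (hγ₀ : 0 < γ) (hγ₁ : γ < 1) (f : C(S, ℝ)) (s : S) :
    HasSum (fun t : ℕ => γ ^ t * (hM.transitionOp hv m ^ t) f s) (hM.resolvent hv γ m f s) := by
  have h := hasSum_geom_series_inverse (γ • hM.transitionOp hv m)
    (hM.norm_discounted_lt_one hv m hγ₀ hγ₁)
  have h' := h.mapL ((ContinuousMap.evalCLM ℝ s).comp
    (ContinuousLinearMap.apply ℝ C(S, ℝ) f))
  convert! h' using 2 with t
  symm
  change ((γ • hM.transitionOp hv m) ^ t) f s = _
  rw [clm_smul_pow_apply]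
  rfl

/-- Bounded rewards and `γ < 1` allow expectation and series to be exchanged. This turns the
probabilistic value into an expression that operator calculus can differentiate. -/
theorem MDP.IsRegular.value_eq_resolvent (hM : M.IsRegular) (hv : v ≠ 0) (m : C(S, ℝ)) {γ : ℝ}
    (hγ₀ : 0 < γ) (hγ₁ : γ < 1) (s : S) :
    M.value γ (gaussianPolicy v m) s =
      hM.resolvent hv γ m (actionMean hv m hM.isActionFunction_r) s := by
  obtain ⟨B, hB⟩ := hM.r_bdd
  have h := hM.hasSum_resolvent hv m hγ₀ hγ₁ (actionMean hv m hM.isActionFunction_r) s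
  rw [← h.tsum_eq, MDP.value]
  have hmeas : ∀ t : ℕ, Measurable fun ω : ℕ → S × ℝ => M.r (ω t).1 (ω t).2 := fun t =>
    M.r_measurable.comp (measurable_pi_apply t)
  have hb : ∀ (t : ℕ) (ω : ℕ → S × ℝ), ‖γ ^ t * M.r (ω t).1 (ω t).2‖ ≤ γ ^ t * B := fun t ω => by
    rw [norm_mul, norm_pow, Real.norm_of_nonneg hγ₀.le]
    exact mul_le_mul_of_nonneg_left (hB _ _) (by positivity)
  have hs := hasSum_integral_of_dominated_convergence
    (μ := M.trajectoryLaw (gaussianPolicy v m) s)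
    (F := fun t ω => γ ^ t * M.r (ω t).1 (ω t).2)
    (f := fun ω => ∑' t, γ ^ t * M.r (ω t).1 (ω t).2) (fun t _ => γ ^ t * B)
    (fun t => ((hmeas t).const_mul _).aestronglyMeasurable)
    (fun t => ae_of_all _ (hb t))
    (ae_of_all _ fun _ => (summable_geometric_of_lt_one hγ₀.le hγ₁).mul_right B)
    (integrable_const _)
    (ae_of_all _ fun ω => (Summable.of_norm_bounded
      ((summable_geometric_of_lt_one hγ₀.le hγ₁).mul_right B) fun t => hb t ω).hasSum)
  rw [← hs.tsum_eq]
  simp only [integral_const_mul, hM.integral_trajectoryLaw hv m s _ hM.isActionFunction_r]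

/-- The discounted sum over `t ≥ 1` of the state densities. -/
noncomputable def MDP.discountedDensity (M : MDP S) (v : NNReal) (γ : ℝ) (m : C(S, ℝ))
    (s x : S) : ℝ :=
  ∑' t : ℕ, γ ^ (t + 1) * M.stateDensity v m t s x

/-- The term at time zero is a point mass and stands apart; `stateDensity` at index `t` belongs to
time `t + 1`, hence the exponent. -/
theorem MDP.IsRegular.resolvent_apply (hM : M.IsRegular) (hv : v ≠ 0) (m : C(S, ℝ)) {γ : ℝ}
    (hγ₀ : 0 < γ) (hγ₁ : γ < 1) (f : C(S, ℝ)) (s : S) :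
    hM.resolvent hv γ m f s = f s + ∑' t : ℕ, γ ^ (t + 1) * ∫ x, M.stateDensity v m t s x * f x := by
  have h := hM.hasSum_resolvent hv m hγ₀ hγ₁ f s
  rw [← h.tsum_eq, h.summable.tsum_eq_zero_add]
  simp only [pow_zero, one_mul, hM.integral_stateDensity_mul hv]
  rfl

theorem MDP.IsRegular.summable_discountedDensity (hM : M.IsRegular) (hv : v ≠ 0) (m : C(S, ℝ))
    {γ : ℝ} (hγ₀ : 0 < γ) (hγ₁ : γ < 1) (s x : S) :
    Summable fun t : ℕ => γ ^ (t + 1) * M.stateDensity v m t s x := by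
  obtain ⟨B, hB⟩ := hM.p_bdd
  refine Summable.of_nonneg_of_le (fun t => mul_nonneg (by positivity)
    (M.stateDensity_nonneg v m t s x)) (fun t => mul_le_mul_of_nonneg_left
    (hM.stateDensity_le hv m hB t s x) (by positivity)) (Summable.mul_right B ?_)
  exact (summable_nat_add_iff 1).2 (summable_geometric_of_lt_one hγ₀.le hγ₁)

theorem MDP.IsRegular.resolvent_eq_discountedDensity (hM : M.IsRegular) (hv : v ≠ 0)
    (m : C(S, ℝ)) {γ : ℝ} (hγ₀ : 0 < γ) (hγ₁ : γ < 1) (f : C(S, ℝ)) (s : S) :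
    hM.resolvent hv γ m f s = f s + ∫ x, M.discountedDensity v γ m s x * f x := by
  rw [hM.resolvent_apply hv m hγ₀ hγ₁]
  congr 1
  obtain ⟨B, hB⟩ := hM.p_bdd
  have hb : ∀ (t : ℕ) (x : S), ‖γ ^ (t + 1) * (M.stateDensity v m t s x * f x)‖ ≤
      γ ^ (t + 1) * (B * ‖f‖) := fun t x => by
    have h0 := M.stateDensity_nonneg v m t s x
    rw [norm_mul, norm_mul, Real.norm_of_nonneg h0, norm_pow, Real.norm_of_nonneg hγ₀.le]
    have h1 := hM.stateDensity_le hv m hB t s x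
    exact mul_le_mul_of_nonneg_left (mul_le_mul h1 (f.norm_coe_le_norm x) (norm_nonneg _)
      (h0.trans h1)) (by positivity)
  have hg : Summable fun t : ℕ => γ ^ (t + 1) :=
    (summable_nat_add_iff 1).2 (summable_geometric_of_lt_one hγ₀.le hγ₁)
  have hs := hasSum_integral_of_dominated_convergence (μ := (volume : Measure S))
    (F := fun t x => γ ^ (t + 1) * (M.stateDensity v m t s x * f x))
    (f := fun x => M.discountedDensity v γ m s x * f x) (fun t _ => γ ^ (t + 1) * (B * ‖f‖))
    (fun t => (((hM.continuous_stateDensity hv m t s).mul f.continuous).const_mul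
      _).aestronglyMeasurable)
    (fun t => ae_of_all _ (hb t))
    (ae_of_all _ fun _ => hg.mul_right _)
    (integrable_const _)
    (ae_of_all _ fun x => by
      have := (hM.summable_discountedDensity hv m hγ₀ hγ₁ s x).hasSum.mul_right (f x)
      simp only [mul_assoc] at this
      exact this)
  rw [← hs.tsum_eq]
  simp only [integral_const_mul]

theorem MDP.discountedDensity_nonneg (M : MDP S) (v : NNReal) (m : C(S, ℝ)) {γ : ℝ} (hγ₀ : 0 < γ)
    (s x : S) : 0 ≤ M.discountedDensity v γ m s x :=
  tsum_nonneg fun t => mul_nonneg (by positivity) (M.stateDensity_nonneg v m t s x)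

theorem MDP.IsRegular.exists_discountedDensity_le (hM : M.IsRegular) (hv : v ≠ 0) (m : C(S, ℝ))
    {γ : ℝ} (hγ₀ : 0 < γ) (hγ₁ : γ < 1) :
    ∃ K : ℝ, ∀ s x, M.discountedDensity v γ m s x ≤ K := by
  obtain ⟨B, hB⟩ := hM.p_bdd
  have hg : Summable fun t : ℕ => γ ^ (t + 1) :=
    (summable_nat_add_iff 1).2 (summable_geometric_of_lt_one hγ₀.le hγ₁)
  exact ⟨_, fun s x => (hM.summable_discountedDensity hv m hγ₀ hγ₁ s x).tsum_le_tsum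
    (fun t => mul_le_mul_of_nonneg_left (hM.stateDensity_le hv m hB t s x) (by positivity))
    (hg.mul_right B)⟩

theorem MDP.IsRegular.measurable_discountedDensity (hM : M.IsRegular) (hv : v ≠ 0) (m : C(S, ℝ))
    {γ : ℝ} (s : S) : Measurable (M.discountedDensity v γ m s) :=
  Measurable.tsum fun t => (hM.continuous_stateDensity hv m t s).measurable.const_mul _

theorem MDP.IsRegular.stateDensity_eq_zero_of_discountedDensity (hM : M.IsRegular) (hv : v ≠ 0)
    (m : C(S, ℝ)) {γ : ℝ} (hγ₀ : 0 < γ) (hγ₁ : γ < 1) {s x : S}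
    (h : M.discountedDensity v γ m s x = 0) (t : ℕ) : M.stateDensity v m t s x = 0 := by
  have hs := (hM.summable_discountedDensity hv m hγ₀ hγ₁ s x).hasSum
  rw [show ∑' t : ℕ, γ ^ (t + 1) * M.stateDensity v m t s x = 0 from h,
    hasSum_zero_iff_of_nonneg fun t => mul_nonneg (by positivity)
      (M.stateDensity_nonneg v m t s x)] at hs
  have := congrFun hs t
  exact (mul_eq_zero.1 this).resolve_left (by positivity)

end OnlinePG

/-! ### Differentiating the value: the policy gradient theorem. -/

namespace OnlinePG

open Filter Topology Asymptotics

/-- A product rule in which `A` need only be continuous: since `ψ e = 0`, the term containing a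
derivative of `A` would be multiplied by zero. -/
theorem hasFDerivAt_clm_apply_of_eq_zero {E X Y : Type*} [NormedAddCommGroup E] [NormedSpace ℝ E]
    [NormedAddCommGroup X] [NormedSpace ℝ X] [NormedAddCommGroup Y] [NormedSpace ℝ Y]
    {A : E → X →L[ℝ] Y} {ψ : E → X} {ψ' : E →L[ℝ] X} {e : E} (hA : ContinuousAt A e)
    (hψ : HasFDerivAt ψ ψ' e) (h0 : ψ e = 0) :
    HasFDerivAt (fun x => A x (ψ x)) ((A e).comp ψ') e := by
  rw [hasFDerivAt_iff_isLittleO] at hψ ⊢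
  simp only [h0, sub_zero, map_zero] at hψ ⊢
  have h1 : (fun x => A x (ψ x - ψ' (x - e))) =o[𝓝 e] fun x => x - e := by
    have hb : (fun x => ‖A x‖) =O[𝓝 e] fun _ => (1 : ℝ) := hA.norm.isBigO_one ℝ
    have := hb.mul_isLittleO hψ.norm_norm
    simp only [one_mul] at this
    exact (IsBigO.of_norm_le fun x => (A x).le_opNorm _).trans_isLittleO this |>.of_norm_right
  have h2 : (fun x => (A x - A e) (ψ' (x - e))) =o[𝓝 e] fun x => x - e := by
    have ha : (fun x => ‖A x - A e‖) =o[𝓝 e] fun _ => (1 : ℝ) := by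
      rw [isLittleO_one_iff]
      exact tendsto_iff_norm_sub_tendsto_zero.1 hA
    have := ha.mul_isBigO (ψ'.isBigO_sub (𝓝 e) e).norm_norm
    simp only [one_mul] at this
    exact (IsBigO.of_norm_le fun x => (A x - A e).le_opNorm _).trans_isLittleO this |>.of_norm_right
  refine (h1.add h2).congr_left fun x => ?_
  simp only [map_sub, sub_apply, ContinuousLinearMap.comp_apply]
  abel

/-- Derivative of the solution `V x` of the fixed-point equation `V x = R x + T x (V x)`. -/
theorem hasFDerivAt_inverse_one_sub_apply {E X : Type*} [NormedAddCommGroup E] [NormedSpace ℝ E]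
    [NormedAddCommGroup X] [NormedSpace ℝ X] [CompleteSpace X]
    {T : E → X →L[ℝ] X} {R V : E → X} {L : E →L[ℝ] X} {e : E} (hT : ∀ x, ‖T x‖ < 1)
    (hTc : ContinuousAt T e) (hV : ∀ x, V x = Ring.inverse (1 - T x) (R x))
    (hL : HasFDerivAt (fun x => R x + T x (V e)) L e) :
    HasFDerivAt V ((Ring.inverse (1 - T e)).comp L) e := by
  have hunit : ∀ x, IsUnit (1 - T x) := fun x => (Units.oneSub (T x) (hT x)).isUnit
  have hR : ∀ x, R x = V x - T x (V x) := fun x => by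
    have h := congrArg (fun A : X →L[ℝ] X => A (R x)) (Ring.mul_inverse_cancel _ (hunit x))
    simp only [ContinuousLinearMap.mul_def, ContinuousLinearMap.comp_apply, ← hV,
      sub_apply, one_apply_eq_self] at h
    exact h.symm
  have hA : ContinuousAt (fun x => Ring.inverse (1 - T x)) e := by
    obtain ⟨u, hu⟩ := hunit e
    have h1 : ContinuousAt (fun x => 1 - T x) e := continuousAt_const.sub hTc
    have h2 := NormedRing.inverse_continuousAt u
    rw [hu] at h2
    exact ContinuousAt.comp (f := fun x => 1 - T x) h2 h1
  -- The identity used is `V x - V e = (1 - T x)⁻¹ (R x + T x (V e) - V e)`. The bracket vanishes at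
  -- `e`, so the inverse need not be differentiated.
  have h := hasFDerivAt_clm_apply_of_eq_zero hA (hL.sub_const (V e)) (by rw [hR]; abel)
  refine (h.add_const (V e)).congr_of_eventuallyEq (Eventually.of_forall fun x => ?_)
  have hinv := congrArg (fun A : X →L[ℝ] X => A (V e)) (Ring.inverse_mul_cancel _ (hunit x))
  simp only [ContinuousLinearMap.mul_def, ContinuousLinearMap.comp_apply,
    sub_apply, one_apply_eq_self, map_sub] at hinv
  simp only [map_add, map_sub, ← hV]
  rw [sub_eq_iff_eq_add] at hinv
  rw [hinv]
  abel

variable {n : ℕ} {S : TopologicalSpace.Compacts (EuclideanSpace ℝ (Fin n))}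
variable {M : MDP S} {v : NNReal}

theorem hasFDerivAt_actionMean (hv : v ≠ 0) {F : S → ℝ → ℝ} (hF : IsActionFunction F)
    (m : C(S, ℝ)) :
    HasFDerivAt (fun m => actionMean hv m hF)
      (ContinuousLinearMap.mul ℝ C(S, ℝ) (scoreMean hv m hF)) m := by
  obtain ⟨C, hC0, hC⟩ := exists_gaussian_expansion hv
  obtain ⟨B, hB⟩ := hF.bdd
  -- `B` may be negative when `S` is empty, hence the absolute value.
  have hK0 : 0 ≤ C * |B| := by positivity
  rw [hasFDerivAt_iff_isLittleO]
  have hq : (fun m' : C(S, ℝ) => ‖m' - m‖ ^ 2) =o[𝓝 m] fun m' => m' - m := by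
    have h1 : (fun g : C(S, ℝ) => ‖g‖ ^ 2) =o[𝓝 0] fun g => g :=
      isLittleO_norm_pow_id one_lt_two
    have h2 : Tendsto (fun m' : C(S, ℝ) => m' - m) (𝓝 m) (𝓝 0) := by
      have : Continuous fun m' : C(S, ℝ) => m' - m := continuous_id.sub continuous_const
      simpa using this.tendsto m
    exact h1.comp_tendsto h2
  refine IsBigO.trans_isLittleO (IsBigO.of_bound (C * |B|) ?_) hq
  filter_upwards [Metric.ball_mem_nhds m one_pos] with m' hm'
  rw [mem_ball_iff_norm] at hm'
  rw [norm_pow, norm_norm, ContinuousMap.norm_le _ (by positivity)]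
  intro s
  have hs : |m' s - m s| ≤ ‖m' - m‖ := (m' - m).norm_coe_le_norm s
  have h := hC (m s) (m' s - m s) |B| (F s) (hs.trans hm'.le) (hF.measurable_right s)
    fun a => (hB s a).trans (le_abs_self B)
  rw [add_sub_cancel, mul_comm (m' s - m s)] at h
  refine h.trans (mul_le_mul_of_nonneg_left ?_ hK0)
  rw [← sq_abs]
  gcongr

theorem continuousAt_of_norm_sub_le {E F : Type*} [NormedAddCommGroup E] [NormedAddCommGroup F]
    {f : E → F} {x : E} {C : ℝ} (h : ∀ y, ‖y - x‖ < 1 → ‖f y - f x‖ ≤ C * ‖y - x‖) :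
    ContinuousAt f x :=
  continuousAt_of_locally_lipschitz one_pos C fun y hy => by
    rw [dist_eq_norm] at hy ⊢
    rw [dist_eq_norm]
    exact h y hy

theorem MDP.IsRegular.continuous_transitionOp (hM : M.IsRegular) (hv : v ≠ 0) :
    Continuous (hM.transitionOp hv) := by
  obtain ⟨C, hC0, hC⟩ := exists_gaussian_lipschitz hv
  rw [continuous_iff_continuousAt]
  intro m
  refine continuousAt_of_norm_sub_le (E := C(S, ℝ))
    (F := C(S, ℝ) →L[ℝ] C(S, ℝ)) (C := C) fun m' hm' => ?_
  refine ContinuousLinearMap.opNorm_le_bound _ (by positivity) fun f => ?_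
  rw [ContinuousMap.norm_le _ (by positivity)]
  intro s
  have hs : |m' s - m s| ≤ ‖m' - m‖ := (m' - m).norm_coe_le_norm s
  have h := hC (m s) (m' s - m s) ‖f‖ (M.lookahead f s) (hs.trans hm'.le)
    ((hM.isActionFunction_lookahead f).measurable_right s)
    (M.abs_lookahead_le f.norm_coe_le_norm s)
  rw [add_sub_cancel] at h
  refine h.trans ?_
  calc C * ‖f‖ * |m' s - m s| ≤ C * ‖f‖ * ‖m' - m‖ := by gcongr
    _ = C * ‖m' - m‖ * ‖f‖ := by ring

/-- The value function of a Gaussian policy, as a continuous function of the initial state. -/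
noncomputable def MDP.IsRegular.valueFn (hM : M.IsRegular) (hv : v ≠ 0) (γ : ℝ) (m : C(S, ℝ)) :
    C(S, ℝ) :=
  hM.resolvent hv γ m (actionMean hv m hM.isActionFunction_r)

/-- The state-action value function of a Gaussian policy is an action function. -/
theorem MDP.IsRegular.isActionFunction_Q (hM : M.IsRegular) (hv : v ≠ 0) (γ : ℝ) (m : C(S, ℝ)) :
    IsActionFunction fun s a => M.r s a + γ * M.lookahead (hM.valueFn hv γ m) s a :=
  hM.isActionFunction_r.add ((hM.isActionFunction_lookahead _).const_mul γ)

/-- The score average of the state-action value function: the density of the policy gradient. -/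
noncomputable def MDP.IsRegular.advantage (hM : M.IsRegular) (hv : v ≠ 0) (γ : ℝ) (m : C(S, ℝ)) :
    C(S, ℝ) :=
  scoreMean hv m (hM.isActionFunction_Q hv γ m)

/-- The policy gradient theorem. -/
theorem MDP.IsRegular.hasFDerivAt_valueFn (hM : M.IsRegular) (hv : v ≠ 0) {γ : ℝ}
    (hγ₀ : 0 < γ) (hγ₁ : γ < 1) (m : C(S, ℝ)) :
    HasFDerivAt (hM.valueFn hv γ)
      ((hM.resolvent hv γ m).comp
        (ContinuousLinearMap.mul ℝ C(S, ℝ) (hM.advantage hv γ m))) m := by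
  refine hasFDerivAt_inverse_one_sub_apply (T := fun m => γ • hM.transitionOp hv m)
    (R := fun m => actionMean hv m hM.isActionFunction_r)
    (fun m => hM.norm_discounted_lt_one hv m hγ₀ hγ₁)
    ((hM.continuous_transitionOp hv).const_smul γ).continuousAt (fun _ => rfl) ?_
  -- With the value function frozen at `m`, reward plus discounted transition is the action mean of
  -- a fixed `Q`; its derivative is multiplication by the advantage.
  refine (hasFDerivAt_actionMean hv (hM.isActionFunction_Q hv γ m) m).congr_of_eventuallyEq
    (Eventually.of_forall fun m' => ?_)
  ext s
  have hr := integrable_gaussianPDFReal_mul hM.isActionFunction_r (m' s) v s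
  have hl := integrable_gaussianPDFReal_mul
    ((hM.isActionFunction_lookahead (hM.valueFn hv γ m)).const_mul γ) (m' s) v s
  have h := integral_add hr hl
  simp only [mul_left_comm _ γ, integral_const_mul] at h
  exact h.symm.trans (by
    simp only [mul_add, mul_left_comm _ γ, actionMean, ContinuousMap.coe_mk])

/-! ### Criticality in the reproducing kernel Hilbert space. -/

section RKHS

variable {H : Type*} [NormedAddCommGroup H] [InnerProductSpace ℝ H] [CompleteSpace H]
  [RKHS ℝ H S ℝ]

theorem inner_kerFun_kerFun (x y : S) :
    inner ℝ (RKHS.kerFun H x (1 : ℝ)) (RKHS.kerFun H y (1 : ℝ)) = scalarKernel H y x := by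
  rw [← RKHS.kernel_inner]
  simp [scalarKernel]

theorem scalarKernel_comm (x y : S) : scalarKernel H x y = scalarKernel H y x := by
  rw [← inner_kerFun_kerFun, ← inner_kerFun_kerFun, real_inner_comm]

theorem apply_eq_inner_kerFun (h : H) (x : S) : h x = inner ℝ (RKHS.kerFun H x (1 : ℝ)) h := by
  rw [RKHS.kerFun_inner, real_inner_eq_re_inner]
  simp

theorem kerFun_one_apply (x y : S) : (RKHS.kerFun H y (1 : ℝ)) x = scalarKernel H x y := by
  rw [apply_eq_inner_kerFun, inner_kerFun_kerFun, scalarKernel_comm]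

/-- The inclusion of a reproducing kernel Hilbert space with continuous kernel into the space of
continuous functions. -/
theorem exists_meanMap_clm (hκ : Continuous fun x : S × S => scalarKernel H x.1 x.2) :
    ∃ J : H →L[ℝ] C(S, ℝ), ∀ h, J h = meanMap hκ h := by
  have hd : Continuous fun x : S => √(scalarKernel H x x) :=
    (hκ.comp' (f := fun x : S => (x, x)) (by fun_prop)).sqrt
  obtain ⟨K, hK⟩ := (isCompact_range hd).bddAbove
  have hK' : ∀ x : S, ‖RKHS.kerFun H x (1 : ℝ)‖ ≤ |K| := fun x => by
    refine le_trans (le_of_eq ?_) ((hK ⟨x, rfl⟩).trans (le_abs_self K))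
    simp only [← inner_kerFun_kerFun, real_inner_self_eq_norm_sq, Real.sqrt_sq (norm_nonneg _)]
  refine ⟨LinearMap.mkContinuous
    { toFun := fun h => meanMap hκ h
      map_add' := fun f g => by ext s; simp [meanMap]
      map_smul' := fun c f => by ext s; simp [meanMap] } |K| fun h => ?_, fun h => rfl⟩
  refine (ContinuousMap.norm_le _ (by positivity)).2 fun x => ?_
  change ‖h x‖ ≤ _
  rw [apply_eq_inner_kerFun]
  exact (norm_inner_le_norm _ _).trans (mul_le_mul_of_nonneg_right (hK' x) (norm_nonneg _))

/-- `U_s` is evaluation at `s` after `valueFn` after the bounded inclusion of `H` into `C(S, ℝ)`. It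
is therefore always differentiable, and criticality reduces to the vanishing of the chain-rule
derivative. -/
theorem MDP.IsRegular.isCriticalPoint_iff (hM : M.IsRegular) (hv : v ≠ 0) {γ : ℝ}
    (hγ₀ : 0 < γ) (hγ₁ : γ < 1) (hκ : Continuous fun x : S × S => scalarKernel H x.1 x.2)
    (s : S) (h : H) :
    IsCriticalPoint (M.U γ v hκ s) h ↔ ∀ g : H, hM.resolvent hv γ (meanMap hκ h)
      (hM.advantage hv γ (meanMap hκ h) * meanMap hκ g) s = 0 := by
  obtain ⟨J, hJ⟩ := exists_meanMap_clm hκ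
  have hU : M.U γ v hκ s = fun h => hM.valueFn hv γ (J h) s := by
    funext h
    rw [hJ]
    exact hM.value_eq_resolvent hv (meanMap hκ h) hγ₀ hγ₁ s
  have hd : HasFDerivAt (M.U γ v hκ s) ((ContinuousMap.evalCLM ℝ s).comp
      (((hM.resolvent hv γ (J h)).comp
        (ContinuousLinearMap.mul ℝ C(S, ℝ) (hM.advantage hv γ (J h)))).comp J)) h := by
    rw [hU]
    exact (ContinuousMap.evalCLM ℝ s).hasFDerivAt.comp h
      ((hM.hasFDerivAt_valueFn hv hγ₀ hγ₁ (J h)).comp h J.hasFDerivAt)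
  rw [IsCriticalPoint, hasGradientAt_iff_hasFDerivAt, map_zero]
  simp only [← hJ]
  constructor
  · intro h0 g
    exact congrArg (fun A : H →L[ℝ] ℝ => A g) (hd.unique h0)
  · intro h0
    refine hd.congr_fderiv (ContinuousLinearMap.ext fun g => ?_)
    exact h0 g

end RKHS

end OnlinePG

/-! ### Reachable states and the vanishing of the advantage. -/

namespace OnlinePG

open Filter Topology

variable {n : ℕ} {S : TopologicalSpace.Compacts (EuclideanSpace ℝ (Fin n))}
variable {M : MDP S} {v : NNReal}

theorem isOpenPosMeasure_volume (hS : ∀ V : Set (EuclideanSpace ℝ (Fin n)), IsOpen V →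
      ((S : Set (EuclideanSpace ℝ (Fin n))) ∩ V).Nonempty →
        0 < volume ((S : Set (EuclideanSpace ℝ (Fin n))) ∩ V)) :
    (volume : Measure S).IsOpenPosMeasure := by
  constructor
  rintro U hU ⟨x, hx⟩
  obtain ⟨V, hV, rfl⟩ := isOpen_induced_iff.1 hU
  have h : (volume : Measure S) (Subtype.val ⁻¹' V) =
      volume ((S : Set (EuclideanSpace ℝ (Fin n))) ∩ V) := by
    have := comap_subtype_coe_apply S.isCompact.measurableSet
      (volume : Measure (EuclideanSpace ℝ (Fin n))) (Subtype.val ⁻¹' V)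
    rw [Subtype.image_preimage_coe] at this
    exact this
  rw [h]
  exact (hS V hV ⟨x, x.2, hx⟩).ne'

/-- The integrand defining the next density is continuous, nonnegative and positive at `s`, so it
has positive integral once open sets have positive measure. -/
theorem MDP.IsRegular.reachable_of_stepDensity_pos (hM : M.IsRegular) (hv : v ≠ 0)
    [(volume : Measure S).IsOpenPosMeasure] (m : C(S, ℝ)) {s₀ s x : S}
    (hs : s ∈ M.reachable v m s₀) (hx : 0 < M.stepDensity v m s x) : x ∈ M.reachable v m s₀ := by
  rcases hs with rfl | ⟨t, ht⟩
  · exact Or.inr ⟨0, hx⟩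
  refine Or.inr ⟨t + 1, ?_⟩
  have hstep : Continuous fun y => M.stepDensity v m y x :=
    (hM.continuous_stepDensity hv m).comp' (f := fun y : S => (y, x)) (by fun_prop)
  exact Continuous.integral_pos_of_hasCompactSupport_nonneg_nonzero (x := s)
    ((hM.continuous_stateDensity hv m t s₀).mul hstep) (HasCompactSupport.of_compactSpace _)
    (fun y => mul_nonneg (M.stateDensity_nonneg v m t s₀ y) (M.stepDensity_nonneg v m y x))
    (mul_pos ht hx).ne'

/-- A positive density at a later time has an intermediate state `y` with both factors positive,
which reduces the claim to single steps. -/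
theorem MDP.IsRegular.reachable_of_stateDensity_pos (hM : M.IsRegular) (hv : v ≠ 0)
    [(volume : Measure S).IsOpenPosMeasure] (m : C(S, ℝ)) {s₀ s : S}
    (hs : s ∈ M.reachable v m s₀) (t : ℕ) :
    ∀ {x : S}, 0 < M.stateDensity v m t s x → x ∈ M.reachable v m s₀ := by
  induction t with
  | zero => exact hM.reachable_of_stepDensity_pos hv m hs
  | succ t ih =>
    intro x hx
    obtain ⟨y, hy⟩ : ∃ y, M.stateDensity v m t s y * M.stepDensity v m y x ≠ 0 := by
      by_contra! h
      have h0 : M.stateDensity v m (t + 1) s x = 0 := by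
        change ∫ y, M.stateDensity v m t s y * M.stepDensity v m y x = 0
        simp only [h, integral_zero]
      exact hx.ne' h0
    exact hM.reachable_of_stepDensity_pos hv m
      (ih ((M.stateDensity_nonneg v m t s y).lt_of_ne' (left_ne_zero_of_mul hy)))
      ((M.stepDensity_nonneg v m y x).lt_of_ne' (right_ne_zero_of_mul hy))

variable {H : Type*} [NormedAddCommGroup H] [InnerProductSpace ℝ H] [CompleteSpace H]
  [RKHS ℝ H S ℝ]

/-- A signed measure `c δ_x + q ds` that annihilates a reproducing kernel Hilbert space with
integrally strictly positive definite kernel vanishes. -/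
theorem IntegrallyStrictlyPosDef.eq_zero_of_annihilates
    (hκ_pos : IntegrallyStrictlyPosDef (scalarKernel H (S := S))) {x : S} {c : ℝ} {q : S → ℝ}
    (hq : MemLp q 2 volume) (h : ∀ g : H, c * g x + ∫ y, q y * g y = 0) :
    c = 0 ∧ q =ᵐ[volume] 0 := by
  by_contra hne
  have hpos := hκ_pos x c q hq hne
  -- Testing on the kernel section at `z` shows that the potential of `q ds` cancels that of `c δ_x`
  -- at every point. The energy becomes `(c² - 2c² + c²) κ(x, x) = 0`, contradicting `hpos`.
  have hker : ∀ z : S, ∫ y, q y * scalarKernel H z y = -(c * scalarKernel H x z) := fun z => by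
    have := h (RKHS.kerFun H z (1 : ℝ))
    simp only [kerFun_one_apply, scalarKernel_comm _ z] at this
    rw [scalarKernel_comm x z]
    linarith
  have e1 : ∀ s : S, ∫ s', q s * scalarKernel H s s' * q s' = -c * (scalarKernel H x s * q s) :=
    fun s => by
      have e : ∀ s', q s * scalarKernel H s s' * q s' = q s * (q s' * scalarKernel H s s') :=
        fun s' => by ring
      simp only [e, integral_const_mul, hker]
      ring
  have e2 : ∫ s, scalarKernel H x s * q s = -(c * scalarKernel H x x) := by
    rw [← hker x]
    simp only [mul_comm]
  simp only [e1, integral_const_mul, e2] at hpos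
  nlinarith

theorem MDP.IsRegular.advantage_eq_zero_of_reachable (hM : M.IsRegular) (hv : v ≠ 0) {γ : ℝ}
    (hγ₀ : 0 < γ) (hγ₁ : γ < 1) [(volume : Measure S).IsOpenPosMeasure]
    (hκ : Continuous fun x : S × S => scalarKernel H x.1 x.2)
    (hκ_pos : IntegrallyStrictlyPosDef (scalarKernel H (S := S))) {s₀ : S} {h : H}
    (hcrit : IsCriticalPoint (M.U γ v hκ s₀) h) {s : S}
    (hs : s ∈ M.reachable v (meanMap hκ h) s₀) :
    hM.advantage hv γ (meanMap hκ h) s = 0 := by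
  rw [hM.isCriticalPoint_iff hv hγ₀ hγ₁] at hcrit
  set m := meanMap hκ h
  set D := hM.advantage hv γ m
  obtain ⟨K, hK⟩ := hM.exists_discountedDensity_le hv m hγ₀ hγ₁
  have hρ0 := M.discountedDensity_nonneg v m hγ₀ s₀
  have hq : MemLp (fun x => M.discountedDensity v γ m s₀ x * D x) 2 volume := by
    refine MemLp.of_bound (((hM.measurable_discountedDensity hv m s₀).mul
      D.continuous.measurable).aestronglyMeasurable) (K * ‖D‖) (ae_of_all _ fun x => ?_)
    rw [norm_mul, Real.norm_of_nonneg (hρ0 x)]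
    exact mul_le_mul (hK s₀ x) (D.norm_coe_le_norm x) (norm_nonneg _) ((hρ0 x).trans (hK s₀ x))
  obtain ⟨hD, hae⟩ := hκ_pos.eq_zero_of_annihilates (x := s₀) (c := D s₀) hq fun g => by
    have := hcrit g
    rw [hM.resolvent_eq_discountedDensity hv m hγ₀ hγ₁] at this
    simp only [mul_assoc]
    exact this
  rcases hs with rfl | ⟨t, ht⟩
  · exact hD
  -- Where the discounted density is zero, so is each of its nonnegative terms. Passing to a single
  -- time gives a continuous function, for which vanishing almost everywhere means vanishing
  -- everywhere.
  have hz : (fun x => M.stateDensity v m t s₀ x * D x) =ᵐ[volume] fun _ => 0 := by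
    filter_upwards [hae] with x hx
    rcases mul_eq_zero.1 hx with h0 | h0
    · rw [hM.stateDensity_eq_zero_of_discountedDensity hv m hγ₀ hγ₁ h0, zero_mul]
    · rw [h0, mul_zero]
  have hz' := (((hM.continuous_stateDensity hv m t s₀).mul D.continuous).ae_eq_iff_eq volume
    continuous_const).1 hz
  exact (mul_eq_zero.1 (congrFun hz' s)).resolve_left ht.ne'

end OnlinePG

/-! ### The proposition. -/

theorem mainTheorem2 {n : ℕ} (S : TopologicalSpace.Compacts (EuclideanSpace ℝ (Fin n)))
    (hS : ∀ V : Set (EuclideanSpace ℝ (Fin n)), IsOpen V →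
      ((S : Set (EuclideanSpace ℝ (Fin n))) ∩ V).Nonempty →
        0 < volume ((S : Set (EuclideanSpace ℝ (Fin n))) ∩ V))
    (M : OnlinePG.MDP S)
    (hp_bdd : ∃ B : ℝ, ∀ s a s', M.p s a s' ≤ B)
    (hp_cont : ∀ a : ℝ, Continuous fun x : S × S => M.p x.1 a x.2)
    (hr_bdd : ∃ B : ℝ, ∀ s a, |M.r s a| ≤ B)
    (hr_cont : ∀ a : ℝ, Continuous fun s : S => M.r s a)
    (γ : ℝ) (hγ₀ : 0 < γ) (hγ₁ : γ < 1)
    (v : NNReal) (hv : 0 < v)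
    (H : Type*) [NormedAddCommGroup H] [InnerProductSpace ℝ H] [CompleteSpace H]
    [RKHS ℝ H S ℝ]
    (hκ : Continuous fun x : S × S => OnlinePG.scalarKernel H x.1 x.2)
    (hκ_pos : OnlinePG.IntegrallyStrictlyPosDef (OnlinePG.scalarKernel H (S := S)))
    (s₀ : S) (h : H)
    (hcrit : OnlinePG.IsCriticalPoint (M.U γ v hκ s₀) h) :
    ∀ s ∈ M.reachable v (OnlinePG.meanMap hκ h) s₀,
      OnlinePG.IsCriticalPoint (M.U γ v hκ s) h := by
  have hM : M.IsRegular := ⟨hp_bdd, hp_cont, hr_bdd, hr_cont⟩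
  have := OnlinePG.isOpenPosMeasure_volume hS
  intro s hs
  have hzero : ∀ x ∈ M.reachable v (OnlinePG.meanMap hκ h) s₀,
      hM.advantage hv.ne' γ (OnlinePG.meanMap hκ h) x = 0 := fun x hx =>
    hM.advantage_eq_zero_of_reachable hv.ne' hγ₀ hγ₁ hκ hκ_pos hcrit hx
  rw [hM.isCriticalPoint_iff hv.ne' hγ₀ hγ₁]
  intro g
  rw [hM.resolvent_apply hv.ne' _ hγ₀ hγ₁]
  -- At each `x` either the density from `s` vanishes, or `x` is reachable from `s`, hence from
  -- `s₀`, and the advantage vanishes.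
  have hint : ∀ (t : ℕ) (x : S), M.stateDensity v (OnlinePG.meanMap hκ h) t s x *
      (hM.advantage hv.ne' γ (OnlinePG.meanMap hκ h) * OnlinePG.meanMap hκ g) x = 0 := by
    intro t x
    rcases (M.stateDensity_nonneg v (OnlinePG.meanMap hκ h) t s x).eq_or_lt with h0 | h0
    · rw [← h0, zero_mul]
    · rw [ContinuousMap.mul_apply,
        hzero x (hM.reachable_of_stateDensity_pos hv.ne' _ hs t h0), zero_mul, mul_zero]
  simp only [hint, integral_zero, mul_zero, tsum_zero, add_zero]
  rw [ContinuousMap.mul_apply, hzero s hs, zero_mul]
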